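/- Let $R$ be the (reduced, irreducible, crystallographic) root system of a complex simple algebraic group $G$ of adjoint type, with simple roots $(\alpha_i)_{i\in S}$, positive roots $R^+$, Weyl group $W$, coroot lattice $Q$ and coweight lattice $P$. Let $W_a = Q\rtimes W$ be the affine Weyl group, a Coxeter group with simple reflections $s_i$ ($i\in S$) and $s_0=t^{-\theta^\vee}s_\theta$, where $\theta$ is the highest root, and let $\widetilde W = P\rtimes W$ be the extended affine Weyl group, with length function $$\ell(t^\chi w)=\sum_{\alpha\in R^+,\ w^{-1}\alpha>0}|\langle\chi,\alpha\rangle|+\sum_{\alpha\in R^+,\ w^{-1}\alpha<0}|\langle\chi,\alpha\rangle+1| .$$ The Bruhat order on $\widetilde W$ is defined by: $\tau_1w_1\le\tau_2w_2$ (with $\ell(\tau_1)=\ell(\tau_2)=0$ and $w_1,w_2\in W_a$) if and only if $\tau_1=\tau_2$ and $w_1\le w_2$ in the Coxeter group $W_a$; write $\le^{op}$ for the opposite order. Let $\lambda\in P$ be a dominant coweight, $J=\{i\in S:\langle\lambda,\alpha_i\rangle=0\}$, $W_J=\langle s_i: i\in J\rangle$, and let $W^J\subset W$ be the set of minimal length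 representatives of $W/W_J$. For $x,x'\in W^J$ and $y,y'\in W$ put $(x',y')\preceq(x,y)$ if there is $u\in W_J$ with $x'u\le x$ and $y'u\ge y$. Let $Q_J=\{(x,y)\in W^J\times W: y\le x\}$, and let $\mathrm{Adm}(-w_S\lambda)=\{z\in\widetilde W: z\le t^{-w\lambda}\text{ for some } w\in W\}$, where $w_S$ is the longest element of $W$. (0) For $x,x'\in W^J$ and $y,y'\in W$ the following are equivalent: (i) $y't^{-\lambda}(x')^{-1}\le yt^{-\lambda}x^{-1}$; (ii) there is $u\in W_J$ with $y'u\le y$ and $xu^{-1}\le x'$; (iii) there is $v\in W_J$ with $y'\le yv$ and $xv\le x'$. (1) $\preceq$ is a partial order on $W^J\times W$, graded by $(x,y)\mapsto\ell(x)-\ell(y)$; the poset $(Wt^{-\lambda}W,\le^{op})$ is graded by $z\mapsto\ell(t^{-\lambda})-\ell(z)$; and the map $(x,y)\mapsto yt^{-\lambda}x^{-1}$ is a rank-preserving isomorphism of posets (a bijection that preserves and reflects the order) from $(W^J\times W,\preceq)$ onto $(Wt^{-\lambda}W,\le^{op})$. (2) It restricts to a rank-preserving isomorphism of graded posets from $(Q_J,\preceq)$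 onto $(Wt^{-\lambda}W\cap\mathrm{Adm}(-w_S\lambda),\le^{op})$, with the same rank functions. (3) If $\lambda$ is cominuscule, that is, $\lambda$ is the fundamental coweight of a simple root that has coefficient one in the highest root, then $Wt^{-\lambda}W\cap\mathrm{Adm}(-w_S\lambda)=\mathrm{Adm}(-w_S\lambda)$. -/

import Mathlib

/-!
Root-theoretic conventions.  A complex simple algebraic group of adjoint type (with a Borel subgroup
and a maximal torus) enters only through its reduced, irreducible, crystallographic root system
`P : RootPairing ι ℝ M N` (roots in `M`, coroots in `N`) with a base `b`; its cocharacter lattice is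
the coweight lattice of `P`.
-/

noncomputable section

namespace ExtAffine

/-! ### Graded posets -/

/-- The relation `r` is a partial order on the set `s`, and `ρ` is a rank function for this poset:
it is strictly increasing and goes up by exactly one along covering relations. -/
structure IsGradedPoset {α : Type*} (s : Set α) (r : α → α → Prop) (ρ : α → ℤ) : Prop where
  refl : ∀ a ∈ s, r a a
  antisymm : ∀ a ∈ s, ∀ c ∈ s, r a c → r c a → a = c
  trans : ∀ a ∈ s, ∀ c ∈ s, ∀ d ∈ s, r a c → r c d → r a d
  strictMono : ∀ a ∈ s, ∀ c ∈ s, r a c → a ≠ c → ρ a < ρ c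
  cover : ∀ a ∈ s, ∀ c ∈ s, r a c → a ≠ c →
    (∀ d ∈ s, r a d → r d c → d = a ∨ d = c) → ρ c = ρ a + 1

/-- `f` is an isomorphism from the graded poset `(s, r, ρ)` onto the graded poset `(t, r', ρ')`. -/
structure IsGradedPosetIso {α β : Type*} (f : α → β) (s : Set α) (r : α → α → Prop) (ρ : α → ℤ)
    (t : Set β) (r' : β → β → Prop) (ρ' : β → ℤ) : Prop where
  source_graded : IsGradedPoset s r ρ
  target_graded : IsGradedPoset t r' ρ'
  bijOn : Set.BijOn f s t
  rel_iff : ∀ a ∈ s, ∀ c ∈ s, r a c ↔ r' (f a) (f c)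
  rank_eq : ∀ a ∈ s, ρ' (f a) = ρ a

/-! ### The Bruhat order of a group with a set of simple reflections -/

section Coxeter

variable {G : Type*} [Group G]

/-- The length of `g` with respect to a set `S` of involutions: the minimal length of a word in `S`
representing `g` (used only for `g` in the subgroup generated by `S`). -/
def wordLength (S : Set G) (g : G) : ℕ :=
  sInf {n | ∃ l : List G, (∀ s ∈ l, s ∈ S) ∧ l.prod = g ∧ l.length = n}

/-- The reflections: the conjugates of the simple reflections `S` in the group generated by `S`. -/
def reflections (S : Set G) : Set G :=
  {t | ∃ g ∈ Subgroup.closure S, ∃ s ∈ S, t = g * s * g⁻¹}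

/-- The Bruhat order of the Coxeter group generated by `S`: the order generated by `u < u * t` for
reflections `t` with `ℓ (u) < ℓ (u * t)`. -/
def coxeterBruhatLE (S : Set G) : G → G → Prop :=
  Relation.ReflTransGen fun u v =>
    (∃ t ∈ reflections S, v = u * t) ∧ wordLength S u < wordLength S v

end Coxeter

/-! ### The extended affine Weyl group -/

variable {ι M N : Type*} [AddCommGroup M] [Module ℝ M] [AddCommGroup N] [Module ℝ N]

/-- The coweight lattice: vectors having integral pairing with every root. -/
def coweightLattice (P : RootPairing ι ℝ M N) : AddSubgroup N where
  carrier := {x | ∀ i, ∃ n : ℤ, P.root' i x = n}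
  zero_mem' i := ⟨0, by simp⟩
  add_mem' := by
    intro x y hx hy i
    obtain ⟨m, hm⟩ := hx i
    obtain ⟨n, hn⟩ := hy i
    exact ⟨m + n, by rw [map_add, hm, hn]; push_cast; rfl⟩
  neg_mem' := by
    intro x hx i
    obtain ⟨m, hm⟩ := hx i
    exact ⟨-m, by rw [map_neg, hm]; push_cast; rfl⟩

/-- The integer `⟨χ, α_i⟩`. -/
def pair {P : RootPairing ι ℝ M N} (χ : coweightLattice P) (i : ι) : ℤ :=
  (χ.2 i).choose

theorem pair_spec {P : RootPairing ι ℝ M N} (χ : coweightLattice P) (i : ι) :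
    P.root' i (χ : N) = (pair χ i : ℝ) :=
  (χ.2 i).choose_spec

/-- The coroot lattice. -/
def corootLattice (P : RootPairing ι ℝ M N) : AddSubgroup N :=
  AddSubgroup.closure (Set.range P.coroot)

/-- The action of the Weyl group on `N`, determined by `⟨w x, w α⟩ = ⟨x, α⟩`; the inverse appears
since an automorphism of a root pairing acts contravariantly on `N`. -/
def weylAct {P : RootPairing ι ℝ M N} (w : P.weylGroup) : N ≃ₗ[ℝ] N :=
  RootPairing.Equiv.coweightEquiv P P (w⁻¹ : P.weylGroup).1

theorem root'_weylAct {P : RootPairing ι ℝ M N} (w : P.weylGroup) (i : ι) (x : N) :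
    P.root' i (weylAct w x) = P.root' (w⁻¹ • i) x := by
  have h := RootPairing.Hom.weight_coweight_transpose_apply P P x (w⁻¹ : P.weylGroup).1.toHom
  have h1 := LinearMap.congr_fun h (P.root i)
  have h2 := RootPairing.Hom.root_weightMap_apply P P i (w⁻¹ : P.weylGroup).1.toHom
  rw [LinearMap.dualMap_apply, h2] at h1
  exact h1.symm

theorem weylAct_coroot {P : RootPairing ι ℝ M N} (w : P.weylGroup) (i : ι) :
    weylAct w (P.coroot i) = P.coroot (w • i) := by
  have h := RootPairing.Hom.coroot_coweightMap_apply P P i (w⁻¹ : P.weylGroup).1.toHom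
  have h3 : ((w⁻¹ : P.weylGroup) : P.Aut).toHom.indexEquiv.symm i = w • i := by
    rw [Equiv.symm_apply_eq]
    change i = w⁻¹ • w • i
    rw [inv_smul_smul]
  rw [h3] at h
  exact h

theorem weylAct_one {P : RootPairing ι ℝ M N} (x : N) :
    weylAct (1 : P.weylGroup) x = x := by
  simp only [weylAct, inv_one]
  rfl

theorem weylAct_mul {P : RootPairing ι ℝ M N} (v w : P.weylGroup) (x : N) :
    weylAct (v * w) x = weylAct v (weylAct w x) := by
  simp only [weylAct, mul_inv_rev]
  rfl

theorem weylAct_mem_coweightLattice {P : RootPairing ι ℝ M N} (w : P.weylGroup) {x : N}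
    (hx : x ∈ coweightLattice P) : weylAct w x ∈ coweightLattice P := fun i => by
  rw [root'_weylAct]
  exact hx _

theorem weylAct_mem_corootLattice {P : RootPairing ι ℝ M N} (w : P.weylGroup) {x : N}
    (hx : x ∈ corootLattice P) : weylAct w x ∈ corootLattice P := by
  induction hx using AddSubgroup.closure_induction with
  | mem x hx =>
    obtain ⟨i, rfl⟩ := hx
    rw [weylAct_coroot]
    exact AddSubgroup.subset_closure ⟨_, rfl⟩
  | zero => rw [map_zero]; exact zero_mem _
  | add x y _ _ hx hy => rw [map_add]; exact add_mem hx hy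
  | neg x _ hx => rw [map_neg]; exact neg_mem hx

/-- The action of `w` on the coweight lattice. -/
def weylActCoweight {P : RootPairing ι ℝ M N} (w : P.weylGroup) :
    coweightLattice P ≃+ coweightLattice P where
  toFun χ := ⟨weylAct w χ, weylAct_mem_coweightLattice w χ.2⟩
  invFun χ := ⟨weylAct w⁻¹ χ, weylAct_mem_coweightLattice w⁻¹ χ.2⟩
  left_inv χ := Subtype.ext (by
    change weylAct w⁻¹ (weylAct w (χ : N)) = χ
    rw [← weylAct_mul, inv_mul_cancel, weylAct_one])
  right_inv χ := Subtype.ext (by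
    change weylAct w (weylAct w⁻¹ (χ : N)) = χ
    rw [← weylAct_mul, mul_inv_cancel, weylAct_one])
  map_add' χ ψ := Subtype.ext (map_add (weylAct w) (χ : N) (ψ : N))

/-- The Weyl group acting on the (multiplicatively written) coweight lattice. -/
def weylHom (P : RootPairing ι ℝ M N) :
    P.weylGroup →* MulAut (Multiplicative (coweightLattice P)) where
  toFun w := (weylActCoweight w).toMultiplicative
  map_one' := by
    ext χ
    exact congrArg Subtype.val (Subtype.ext (weylAct_one (P := P) _) :
      weylActCoweight (1 : P.weylGroup) (Multiplicative.toAdd χ) = Multiplicative.toAdd χ)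
  map_mul' v w := by
    ext χ
    exact weylAct_mul v w _

/-- The extended affine Weyl group: the semidirect product of the coweight lattice and the
Weyl group. -/
abbrev ExtAffineWeyl (P : RootPairing ι ℝ M N) : Type _ :=
  Multiplicative (coweightLattice P) ⋊[weylHom P] P.weylGroup

/-- The translation element `t^χ`. -/
def translation {P : RootPairing ι ℝ M N} (χ : coweightLattice P) : ExtAffineWeyl P :=
  SemidirectProduct.inl (Multiplicative.ofAdd χ)

/-- The inclusion of the Weyl group. -/
def finIncl (P : RootPairing ι ℝ M N) : P.weylGroup →* ExtAffineWeyl P :=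
  SemidirectProduct.inr

/-- The coroot of `α_i` as an element of the coweight lattice. -/
def corootCoweight (P : RootPairing ι ℝ M N) [P.IsCrystallographic] (i : ι) :
    coweightLattice P :=
  ⟨P.coroot i, fun j => by
    obtain ⟨n, hn⟩ := P.exists_value (S := ℤ) j i
    exact ⟨n, hn.symm⟩⟩

/-- The affine Weyl group: the elements `t^χ w` with `χ` in the coroot lattice. -/
def affineWeyl (P : RootPairing ι ℝ M N) : Subgroup (ExtAffineWeyl P) where
  carrier := {z | ((Multiplicative.toAdd z.left : coweightLattice P) : N) ∈ corootLattice P}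
  one_mem' := zero_mem (corootLattice P)
  mul_mem' := by
    intro z z' h h'
    exact add_mem h (weylAct_mem_corootLattice z.right h')
  inv_mem' := by
    intro z h
    exact weylAct_mem_corootLattice z.right⁻¹ (neg_mem h)

section Base

variable {P : RootPairing ι ℝ M N} (b : P.Base)

open Classical in
/-- The length function on the extended affine Weyl group: `ℓ (t^χ w)` is the sum over positive
roots `α` of `|⟨χ, α⟩|` if `w⁻¹ α` is positive, and of `|⟨χ, α⟩ + 1|` if `w⁻¹ α` is negative. -/
def length [Fintype ι] (z : ExtAffineWeyl P) : ℕ :=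
  ∑ i with b.IsPos i,
    if b.IsPos (z.right⁻¹ • i) then (pair (Multiplicative.toAdd z.left) i).natAbs
    else (pair (Multiplicative.toAdd z.left) i + 1).natAbs

/-- `α_i` is the highest root: `α_i - α` is a sum of simple roots for every root `α`. -/
def IsHighestRoot (i : ι) : Prop :=
  ∀ j, P.root i - P.root j ∈ AddSubmonoid.closure (P.root '' b.support)

/-- The simple reflections of the affine Weyl group: the simple reflections `s_i` of the finite Weyl
group together with `s_0 = t^{-θ^∨} s_θ` where `θ` is the highest root. -/
def simpleReflections [P.IsCrystallographic] : Set (ExtAffineWeyl P) :=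
  {s | ∃ i ∈ b.support, s = finIncl P (RootPairing.weylGroup.ofIdx P i)} ∪
  {s | ∃ i, IsHighestRoot b i ∧
    s = translation (-corootCoweight P i) * finIncl P (RootPairing.weylGroup.ofIdx P i)}

/-- The Bruhat order on the extended affine Weyl group: `τ₁ w₁ ≤ τ₂ w₂` if and only if `τ₁ = τ₂` and
`w₁ ≤ w₂` in the affine Weyl group, where `τ₁, τ₂` have length zero. -/
def bruhatLE [Fintype ι] [P.IsCrystallographic] (z₁ z₂ : ExtAffineWeyl P) : Prop :=
  ∃ τ w₁ w₂ : ExtAffineWeyl P, length b τ = 0 ∧ w₁ ∈ affineWeyl P ∧ w₂ ∈ affineWeyl P ∧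
    z₁ = τ * w₁ ∧ z₂ = τ * w₂ ∧ coxeterBruhatLE (simpleReflections b) w₁ w₂

/-- The coweight `lam` is dominant. -/
def IsDominant (lam : coweightLattice P) : Prop :=
  ∀ i ∈ b.support, 0 ≤ pair lam i

/-- The coweight `lam` is cominuscule: it is the fundamental coweight of a simple root that occurs
with coefficient at most one in every positive root (equivalently, with coefficient one in the
highest root). -/
def IsCominuscule (lam : coweightLattice P) : Prop :=
  ∃ i ∈ b.support, pair lam i = 1 ∧ (∀ j ∈ b.support, j ≠ i → pair lam j = 0) ∧
    ∀ k, b.IsPos k → pair lam k ≤ 1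

/-- The set `J` of simple roots orthogonal to `lam`. -/
def stabSimple (lam : coweightLattice P) : Set ι :=
  {i | i ∈ b.support ∧ pair lam i = 0}

/-- The parabolic subgroup `W_J` of the finite Weyl group. -/
def parabolic (P : RootPairing ι ℝ M N) (J : Set ι) : Subgroup P.weylGroup :=
  Subgroup.closure (RootPairing.weylGroup.ofIdx P '' J)

/-- The set `W^J` of minimal length representatives in the Weyl group of the cosets `x W_J`. -/
def minReps [Fintype ι] (J : Set ι) : Set P.weylGroup :=
  {x | ∀ u ∈ parabolic P J, length b (finIncl P x) ≤ length b (finIncl P (x * u))}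

/-- The Bruhat order on the finite Weyl group, as a subgroup of the extended affine one. -/
def finBruhatLE [Fintype ι] [P.IsCrystallographic] (x y : P.weylGroup) : Prop :=
  bruhatLE b (finIncl P x) (finIncl P y)

/-- The relation `(x', y') ⪯ (x, y)` on `W^J × W`: there is `u ∈ W_J` with `x' u ≤ x` and
`y' u ≥ y`. -/
def pairLE [Fintype ι] [P.IsCrystallographic] (J : Set ι) (p' p : P.weylGroup × P.weylGroup) :
    Prop :=
  ∃ u ∈ parabolic P J, finBruhatLE b (p'.1 * u) p.1 ∧ finBruhatLE b p.2 (p'.2 * u)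

/-- The set `W^J × W`. -/
def pairs [Fintype ι] (J : Set ι) : Set (P.weylGroup × P.weylGroup) :=
  minReps b J ×ˢ Set.univ

/-- The set `Q_J` of all `(x, y) ∈ W^J × W` with `y ≤ x`. -/
def pairsQ [Fintype ι] [P.IsCrystallographic] (J : Set ι) : Set (P.weylGroup × P.weylGroup) :=
  {p | p ∈ pairs b J ∧ finBruhatLE b p.2 p.1}

/-- The rank function `(x, y) ↦ ℓ (x) - ℓ (y)`. -/
def pairRank [Fintype ι] (p : P.weylGroup × P.weylGroup) : ℤ :=
  (length b (finIncl P p.1) : ℤ) - length b (finIncl P p.2)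

/-- The map `(x, y) ↦ y t^{-lam} x⁻¹`. -/
def theta (lam : coweightLattice P) (p : P.weylGroup × P.weylGroup) : ExtAffineWeyl P :=
  finIncl P p.2 * translation (-lam) * (finIncl P p.1)⁻¹

/-- The double coset `W t^{-lam} W`. -/
def transDoubleCoset (lam : coweightLattice P) : Set (ExtAffineWeyl P) :=
  DoubleCoset.doubleCoset (translation (-lam)) (finIncl P).range (finIncl P).range

/-- The opposite Bruhat order. -/
def bruhatOp [Fintype ι] [P.IsCrystallographic] (z₁ z₂ : ExtAffineWeyl P) : Prop :=
  bruhatLE b z₂ z₁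

/-- The rank function `z ↦ ℓ (t^{-lam}) - ℓ (z)` for the opposite Bruhat order, normalized so that
`t^{-lam}` has rank zero. -/
def opRank [Fintype ι] (lam : coweightLattice P) (z : ExtAffineWeyl P) : ℤ :=
  (length b (translation (-lam)) : ℤ) - length b z

/-- The admissible set `Adm(-w_S lam)`: all `z` with `z ≤ t^{-w lam}` for some `w` in the Weyl
group. -/
def admissible [Fintype ι] [P.IsCrystallographic] (lam : coweightLattice P) :
    Set (ExtAffineWeyl P) :=
  {z | ∃ w : P.weylGroup, bruhatLE b z (translation (-weylActCoweight w lam))}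

end Base

end ExtAffine

end

noncomputable section

namespace ExtAffine

open RootPairing

variable {ι M N : Type*} [AddCommGroup M] [Module ℝ M] [AddCommGroup N] [Module ℝ N]
  {P : RootPairing ι ℝ M N}

/-! ### The Weyl group acting on indices and coweights -/

/-! Write θ(x, y) = y t^{-λ} x⁻¹. If x ∈ W^J, then ℓ(θ(x, y)) = ℓ(t^{-λ}) + ℓ(y) - ℓ(x)
(`length_theta_of_mem_minReps`), and θ is a bijection from W^J × W onto the double coset
(`theta_injOn`, `theta_surjOn`). So raising y or lowering x, up to W_J, moves θ(x, y) up in the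
Bruhat order. The point is that inside the double coset nothing else happens.

To see this, the group acts on affine roots. The length of z counts positive affine roots made
negative by z⁻¹ (`length_eq_ncard`), and the Bruhat order is generated by length-increasing right
multiplications by affine reflections (`bruhatLE_iff`). Let c → c s_a be such a step with a and c a
positive, let n and k be the constant terms of a and c a, and let α be the gradient of c a. Then n,
k ≥ 0, the translation part χ becomes χ - n α^∨, and its W-invariant norm grows by k n |α^∨|². So
the norm never drops, and if it is unchanged then k = 0 or n = 0: the step is a left or right
multiplication by a finite reflection (`BruhatStep.eq_mul_ofIdx_of_normSq_le`). The norm is constant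
on the double coset, hence every chain between two of its elements stays inside it and uses finite
reflections only.

(i) ⇒ (iii): each such step is an instance of the relation `cosetLE` (`BruhatStep.exists_cosetLE`),
which is transitive by the lifting property along W_J. (iii) ⇒ (ii) is another lifting argument
(`exists_inv_of_finLE`). (ii) ⇒ (i): the length formula turns finite Bruhat steps in y, and in x,
into affine ones (`theta_le_of_exists`).

The grading follows from the chain property of the Bruhat order
(`exists_affBruhatLE_length_eq_add_one`) and the convexity of the double coset. For the admissible
set, t^{-wλ} = θ(w, w) = θ(x, x) with x the minimal representative of w W_J, so the criterion
collapses to y ≤ x. For cominuscule λ one has ⟨λ, α⟩ ≤ 1 for all roots, which forces k n = 0 for any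
step that ends in the double coset, so the whole admissible set stays in it. -/

theorem root_weylGroup_smul (w : P.weylGroup) (i : ι) : P.root (w • i) = w • P.root i :=
  (P.weylGroup_apply_root w i).symm

theorem ofIdx_smul_index (i j : ι) :
    (weylGroup.ofIdx P i : P.weylGroup) • j = P.reflectionPerm i j := rfl

theorem ofIdx_mul_self (i : ι) : weylGroup.ofIdx P i * weylGroup.ofIdx P i = 1 := by
  rw [mul_eq_one_iff_inv_eq]
  exact Subtype.ext (Equiv.reflection_inv P i)

theorem ofIdx_inv (i : ι) : (weylGroup.ofIdx P i)⁻¹ = weylGroup.ofIdx P i :=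
  inv_eq_of_mul_eq_one_right (ofIdx_mul_self i)

theorem weylGroup_smul_ext {v w : P.weylGroup} [P.IsRootSystem] (h : ∀ i : ι, v • i = w • i) :
    v = w := by
  apply Subtype.ext
  apply Equiv.weightHom_injective P
  have h1 : ∀ x ∈ Submodule.span ℝ (Set.range P.root), Equiv.weightHom P v.1 x =
      Equiv.weightHom P w.1 x := by
    intro x hx
    induction hx using Submodule.span_induction with
    | mem x hx =>
      obtain ⟨i, rfl⟩ := hx
      change v • P.root i = w • P.root i
      rw [← root_weylGroup_smul, ← root_weylGroup_smul, h]
    | zero => simp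
    | add x y _ _ hx hy => rw [map_add, map_add, hx, hy]
    | smul c x _ hx => rw [map_smul, map_smul, hx]
  ext x
  exact h1 x (by rw [IsRootSystem.span_root_eq_top]; trivial)

theorem ofIdx_weylGroup_smul [P.IsRootSystem] (w : P.weylGroup) (i : ι) :
    weylGroup.ofIdx P (w • i) = w * weylGroup.ofIdx P i * w⁻¹ := by
  apply weylGroup_smul_ext
  intro j
  obtain ⟨k, rfl⟩ : ∃ k, j = w • k := ⟨w⁻¹ • j, by rw [smul_inv_smul]⟩
  rw [mul_smul, inv_smul_smul, mul_smul, ofIdx_smul_index, ofIdx_smul_index]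
  apply P.root.injective
  rw [root_reflectionPerm, root_weylGroup_smul, root_weylGroup_smul,
    root_reflectionPerm, reflection_apply, reflection_apply, smul_sub]
  have h : P.coroot' (w • i) (w • P.root k) = P.coroot' i (P.root k) := by
    have h1 := root'_weylAct w (w • k) (P.coroot i)
    rw [weylAct_coroot, inv_smul_smul, ← root_weylGroup_smul] at *
    exact h1
  rw [h, root_weylGroup_smul]
  congr 1
  exact (map_smul (Equiv.weightHom P w.1) _ _).symm

/-- The index of the negative of a root. -/
def negIdx (P : RootPairing ι ℝ M N) (i : ι) : ι := P.reflectionPerm i i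

@[simp] theorem root_negIdx (i : ι) : P.root (negIdx P i) = -P.root i := by
  simp [negIdx, root_reflectionPerm]

@[simp] theorem negIdx_negIdx (i : ι) : negIdx P (negIdx P i) = i :=
  P.root.injective (by simp)

@[simp] theorem smul_negIdx (w : P.weylGroup) (i : ι) : w • negIdx P i = negIdx P (w • i) :=
  P.root.injective (by
    rw [root_weylGroup_smul, root_negIdx, root_negIdx, root_weylGroup_smul, smul_neg])

theorem root'_negIdx (i : ι) (x : N) : P.root' (negIdx P i) x = -P.root' i x := by
  simp [RootPairing.root']

@[simp] theorem reflectionPerm_negIdx (i j : ι) :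
    P.reflectionPerm i (negIdx P j) = negIdx P (P.reflectionPerm i j) :=
  smul_negIdx (weylGroup.ofIdx P i) j

theorem ofIdx_negIdx [P.IsRootSystem] (i : ι) :
    weylGroup.ofIdx P (negIdx P i) = weylGroup.ofIdx P i := by
  have h := ofIdx_weylGroup_smul (weylGroup.ofIdx P i) i
  rw [ofIdx_smul_index] at h
  rw [negIdx, h, ofIdx_mul_self, one_mul, ofIdx_inv]

/-! ### The pairing -/

theorem pair_eq_iff {χ : coweightLattice P} {i : ι} {n : ℤ} :
    pair χ i = n ↔ P.root' i (χ : N) = (n : ℝ) := by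
  rw [pair_spec, Int.cast_inj]

@[simp] theorem pair_zero (i : ι) : pair (0 : coweightLattice P) i = 0 := by
  rw [pair_eq_iff]; simp

@[simp] theorem pair_add (χ ψ : coweightLattice P) (i : ι) :
    pair (χ + ψ) i = pair χ i + pair ψ i := by
  rw [pair_eq_iff]; push_cast; rw [← pair_spec, ← pair_spec, map_add]

@[simp] theorem pair_neg (χ : coweightLattice P) (i : ι) : pair (-χ) i = -pair χ i := by
  rw [pair_eq_iff]; push_cast; rw [← pair_spec, map_neg]

@[simp] theorem pair_negIdx (χ : coweightLattice P) (i : ι) :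
    pair χ (negIdx P i) = -pair χ i := by
  rw [pair_eq_iff, root'_negIdx]; push_cast; rw [← pair_spec]

theorem pair_weylActCoweight (w : P.weylGroup) (χ : coweightLattice P) (i : ι) :
    pair (weylActCoweight w χ) i = pair χ (w⁻¹ • i) := by
  rw [pair_eq_iff]
  change P.root' i (weylAct w (χ : N)) = _
  rw [root'_weylAct, pair_spec]

@[simp] theorem pair_weylHom (w : P.weylGroup) (χ : Multiplicative (coweightLattice P)) (i : ι) :
    pair (Multiplicative.toAdd (weylHom P w χ)) i = pair (Multiplicative.toAdd χ) (w⁻¹ • i) :=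
  pair_weylActCoweight w _ i

theorem pair_of_root_eq_sub_zsmul {χ : coweightLattice P} {i j k : ι} {n : ℤ}
    (h : P.root k = P.root i - n • P.root j) : pair χ k = pair χ i - n * pair χ j := by
  rw [pair_eq_iff]; push_cast; rw [← pair_spec, ← pair_spec]; simp [RootPairing.root', h]

@[simp] theorem pair_zsmul (n : ℤ) (χ : coweightLattice P) (i : ι) :
    pair (n • χ) i = n * pair χ i := by
  rw [pair_eq_iff]; push_cast; rw [← pair_spec]; simp

theorem pair_ext [P.IsRootSystem] {χ ψ : coweightLattice P} (h : ∀ i, pair χ i = pair ψ i) :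
    χ = ψ := by
  apply Subtype.ext
  rw [← sub_eq_zero]
  refine (eq_zero_iff_forall_coroot'_eq_zero (P := P.flip)).mpr fun i => ?_
  change P.root' i _ = 0
  rw [map_sub, pair_spec, pair_spec, h, sub_self]

@[simp] theorem pair_corootCoweight [P.IsCrystallographic] (i j : ι) :
    pair (corootCoweight P i) j = P.pairingIn ℤ j i := by
  rw [pair_eq_iff]
  exact (P.algebraMap_pairingIn ℤ j i).symm

theorem root_smul_reflectionPerm [P.IsCrystallographic] (w : P.weylGroup) (i j : ι) :
    P.root (w • P.reflectionPerm j i) =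
      P.root (w • i) - P.pairingIn ℤ i j • P.root (w • j) := by
  rw [root_weylGroup_smul, root_reflectionPerm, reflection_apply_root' ℤ, smul_sub,
    root_weylGroup_smul, root_weylGroup_smul]
  congr 1
  exact map_zsmul (Equiv.weightHom P w.1) _ _

/-! ### Affine roots -/

/-- The affine function `v ↦ ⟨v, α⟩ + k`, where `α` is the root with index `idx` and
`k = lvl`. -/
@[ext] structure AffRoot (ι : Type*) where
  /-- the index of the gradient -/
  idx : ι
  /-- the constant term -/
  lvl : ℤ

/-- This is f ↦ f ∘ z⁻¹ on affine functions, where t^χ w sends v to w v + χ: the function ⟨·, α⟩ + k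
becomes ⟨·, wα⟩ + k - ⟨χ, wα⟩. -/
instance : MulAction (ExtAffineWeyl P) (AffRoot ι) where
  smul z a := ⟨z.right • a.idx, a.lvl - pair (Multiplicative.toAdd z.left) (z.right • a.idx)⟩
  one_smul a := by
    change AffRoot.mk ((1 : P.weylGroup) • a.idx) (a.lvl - pair (0 : coweightLattice P) _) = a
    ext <;> simp
  mul_smul z z' a := by
    change AffRoot.mk ((z.right * z'.right) • a.idx) (a.lvl - pair
        (Multiplicative.toAdd z.left + Multiplicative.toAdd (weylHom P z.right z'.left)) _) =
      AffRoot.mk (z.right • z'.right • a.idx) (a.lvl - pair _ _ - pair _ _)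
    ext
    · simp [mul_smul]
    · change a.lvl - pair _ ((z.right * z'.right) • a.idx) = a.lvl - pair _ (z'.right • a.idx) -
        pair _ (z.right • z'.right • a.idx)
      simp only [pair_add, pair_weylHom, mul_smul, inv_smul_smul]
      ring

@[simp] theorem smul_idx (z : ExtAffineWeyl P) (a : AffRoot ι) :
    (z • a).idx = z.right • a.idx := rfl

theorem smul_lvl (z : ExtAffineWeyl P) (a : AffRoot ι) :
    (z • a).lvl = a.lvl - pair (Multiplicative.toAdd z.left) (z.right • a.idx) := rfl

theorem inv_smul_idx (z : ExtAffineWeyl P) (a : AffRoot ι) :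
    (z⁻¹ • a).idx = z.right⁻¹ • a.idx := rfl

theorem inv_smul_lvl (z : ExtAffineWeyl P) (a : AffRoot ι) :
    (z⁻¹ • a).lvl = a.lvl + pair (Multiplicative.toAdd z.left) a.idx := by
  change a.lvl - pair (Multiplicative.toAdd (weylHom P z.right⁻¹ z.left⁻¹)) _ = _
  rw [pair_weylHom, inv_inv]
  change a.lvl - pair (-Multiplicative.toAdd z.left) (z.right • z.right⁻¹ • a.idx) = _
  rw [smul_inv_smul, pair_neg, sub_neg_eq_add]

theorem finIncl_smul (w : P.weylGroup) (a : AffRoot ι) :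
    finIncl P w • a = ⟨w • a.idx, a.lvl⟩ := by
  ext
  · rfl
  · change a.lvl - pair (0 : coweightLattice P) _ = _
    simp

theorem translation_smul (χ : coweightLattice P) (a : AffRoot ι) :
    translation χ • a = ⟨a.idx, a.lvl - pair χ a.idx⟩ := by
  ext
  · change (1 : P.weylGroup) • a.idx = _
    simp
  · change a.lvl - pair χ ((1 : P.weylGroup) • a.idx) = _
    simp

theorem extAffineWeyl_smul_ext [P.IsRootSystem] {z z' : ExtAffineWeyl P}
    (h : ∀ a : AffRoot ι, z • a = z' • a) : z = z' := by
  have hr : z.right = z'.right := weylGroup_smul_ext fun i => by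
    simpa using congrArg AffRoot.idx (h ⟨i, 0⟩)
  refine SemidirectProduct.ext ?_ hr
  refine congrArg Multiplicative.ofAdd (pair_ext (P := P) fun i => ?_ :
    Multiplicative.toAdd z.left = Multiplicative.toAdd z'.left)
  have := congrArg AffRoot.lvl (h ⟨z.right⁻¹ • i, 0⟩)
  simp only [smul_lvl, ← hr, smul_inv_smul] at this
  simpa using this

/-- The negative of an affine root. -/
def AffRoot.neg (P : RootPairing ι ℝ M N) (a : AffRoot ι) : AffRoot ι := ⟨negIdx P a.idx, -a.lvl⟩

@[simp] theorem smul_affRoot_neg (z : ExtAffineWeyl P) (a : AffRoot ι) :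
    z • AffRoot.neg P a = AffRoot.neg P (z • a) := by
  ext
  · simp [AffRoot.neg]
  · simp [AffRoot.neg, smul_lvl]; ring

/-- The reflection in the hyperplane of an affine root. -/
def affReflection (P : RootPairing ι ℝ M N) [P.IsCrystallographic] (a : AffRoot ι) :
    ExtAffineWeyl P :=
  translation (-(a.lvl • corootCoweight P a.idx)) * finIncl P (weylGroup.ofIdx P a.idx)

section

variable [P.IsCrystallographic]

theorem affReflection_smul (a c : AffRoot ι) :
    affReflection P a • c =
      ⟨P.reflectionPerm a.idx c.idx, c.lvl - P.pairingIn ℤ c.idx a.idx * a.lvl⟩ := by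
  rw [affReflection, mul_smul, finIncl_smul, translation_smul]
  ext
  · rfl
  · simp only [pair_neg, pair_zsmul, pair_corootCoweight, ofIdx_smul_index]
    rw [← pairingIn_reflectionPerm, pairingIn_reflectionPerm_self_right]
    ring

theorem affReflection_smul_self (a : AffRoot ι) : affReflection P a • a = AffRoot.neg P a := by
  rw [affReflection_smul, pairingIn_same]
  ext
  · rfl
  · simp only [AffRoot.neg]; ring

variable [P.IsRootSystem]

theorem affReflection_smul_root (z : ExtAffineWeyl P) (a : AffRoot ι) :
    affReflection P (z • a) = z * affReflection P a * z⁻¹ := by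
  apply extAffineWeyl_smul_ext
  intro c
  obtain ⟨d, rfl⟩ : ∃ d, c = z • d := ⟨z⁻¹ • c, by rw [smul_inv_smul]⟩
  rw [mul_smul, inv_smul_smul, mul_smul, affReflection_smul, affReflection_smul]
  have hp : P.pairingIn ℤ (z.right • d.idx) (z.right • a.idx) = P.pairingIn ℤ d.idx a.idx := by
    have h1 := root'_weylAct z.right (z.right • d.idx) (P.coroot a.idx)
    rw [weylAct_coroot, inv_smul_smul, root'_coroot_eq_pairing, root'_coroot_eq_pairing,
      ← P.algebraMap_pairingIn ℤ, ← P.algebraMap_pairingIn ℤ] at h1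
    exact_mod_cast h1
  have hi : P.reflectionPerm (z.right • a.idx) (z.right • d.idx) =
      z.right • P.reflectionPerm a.idx d.idx := by
    rw [← ofIdx_smul_index, ofIdx_weylGroup_smul, mul_smul, inv_smul_smul, mul_smul,
      ofIdx_smul_index]
  ext
  · exact hi
  · have h2 := root_smul_reflectionPerm z.right d.idx a.idx
    have h3 := pair_of_root_eq_sub_zsmul (χ := Multiplicative.toAdd z.left) h2
    simp only [smul_idx, smul_lvl, hp, h3]
    ring

theorem affReflection_mul_self (a : AffRoot ι) :
    affReflection P a * affReflection P a = 1 := by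
  apply extAffineWeyl_smul_ext
  intro c
  rw [mul_smul, affReflection_smul, affReflection_smul, one_smul]
  ext
  · simp
  · simp only
    rw [← pairingIn_reflectionPerm, pairingIn_reflectionPerm_self_right]
    ring

theorem affReflection_inv (a : AffRoot ι) : (affReflection P a)⁻¹ = affReflection P a :=
  inv_eq_of_mul_eq_one_right (affReflection_mul_self a)

theorem affReflection_neg (a : AffRoot ι) :
    affReflection P (AffRoot.neg P a) = affReflection P a := by
  rw [← affReflection_smul_self, affReflection_smul_root, affReflection_mul_self, one_mul,
    affReflection_inv]

theorem finIncl_ofIdx (i : ι) :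
    finIncl P (weylGroup.ofIdx P i) = affReflection P ⟨i, 0⟩ := by
  apply extAffineWeyl_smul_ext
  intro c
  rw [affReflection_smul, finIncl_smul]
  ext <;> simp [ofIdx_smul_index]

end

end ExtAffine

end

noncomputable section

namespace ExtAffine

open RootPairing

variable {ι M N : Type*} [AddCommGroup M] [Module ℝ M] [AddCommGroup N] [Module ℝ N]
  {P : RootPairing ι ℝ M N}

/-! ### Heights and the highest root -/

section Height

variable (b : P.Base)

@[simp] theorem height_negIdx (i : ι) : b.height (negIdx P i) = -b.height i :=
  b.height_reflectionPerm_self i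

theorem isPos_negIdx {i : ι} : b.IsPos (negIdx P i) ↔ ¬ b.IsPos i :=
  Base.IsPos.neg_iff_not b i

theorem root_mem_closure_of_isPos {i : ι} (hi : b.IsPos i) :
    P.root i ∈ AddSubmonoid.closure (P.root '' b.support) := by
  obtain ⟨f, -, hf | hf⟩ := b.exists_root_eq_sum_nat_or_neg i
  · rw [hf]
    exact sum_mem fun j hj =>
      nsmul_mem (AddSubmonoid.subset_closure (Set.mem_image_of_mem P.root hj)) _
  · exfalso
    have h1 : P.root i = ∑ j ∈ b.support, (fun j => -(f j : ℤ)) j • P.root j := by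
      rw [hf, ← Finset.sum_neg_distrib]
      exact Finset.sum_congr rfl fun j _ => by simp
    have h2 := Base.height_eq_sum h1
    rw [Base.isPos_iff, h2] at hi
    exact absurd hi (not_lt.mpr (Finset.sum_nonpos fun j _ => by simp))

/-- The height as a linear functional. -/
def heightFunctional [P.IsRootSystem] : M →ₗ[ℝ] ℝ := ∑ j, b.toWeightBasis.coord j

theorem heightFunctional_root [P.IsRootSystem] (i : ι) :
    heightFunctional b (P.root i) = b.height i := by
  have hs : ∀ j ∈ b.support, heightFunctional b (P.root j) = 1 := by
    intro j hj
    rw [heightFunctional, LinearMap.sum_apply, Finset.sum_eq_single ⟨j, hj⟩]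
    · have := b.toWeightBasis_repr_root ⟨j, hj⟩
      simp only at this
      simp [this]
    · intro k _ hk
      have := b.toWeightBasis_repr_root ⟨j, hj⟩
      simp only at this
      simp [this, hk.symm]
    · simp
  obtain ⟨f, -, -, hf⟩ := b.exists_root_eq_sum_int i
  rw [Base.height_eq_sum hf, hf, map_sum]
  push_cast
  refine Finset.sum_congr rfl fun j hj => ?_
  rw [map_zsmul, hs j hj]
  simp

theorem nonneg_of_mem_closure {f : M →ₗ[ℝ] ℝ} (hf : ∀ j ∈ b.support, 0 ≤ f (P.root j)) {x : M}
    (hx : x ∈ AddSubmonoid.closure (P.root '' b.support)) : 0 ≤ f x := by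
  induction hx using AddSubmonoid.closure_induction with
  | mem x hx =>
    obtain ⟨j, hj, rfl⟩ := hx
    exact hf j hj
  | zero => simp
  | add x y _ _ hx hy => rw [map_add]; exact add_nonneg hx hy

variable [Finite ι]

/-- A root to which no simple root can be added within the positive order. -/
def IsMaximalRoot (i : ι) : Prop :=
  ∀ j, P.root j - P.root i ∈ AddSubmonoid.closure (P.root '' b.support) → j = i

theorem exists_isMaximalRoot_above (j : ι) : ∃ i, IsMaximalRoot b i ∧
    P.root i - P.root j ∈ AddSubmonoid.closure (P.root '' b.support) := by
  obtain ⟨i, hi, hmax⟩ := Set.exists_max_image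
    {i | P.root i - P.root j ∈ AddSubmonoid.closure (P.root '' b.support)} b.height
    (Set.toFinite _) ⟨j, by simp⟩
  refine ⟨i, fun k hk => ?_, hi⟩
  have h1 := hmax k (by
    have := add_mem hk hi
    rwa [sub_add_sub_cancel] at this)
  by_contra hne
  have key : ∀ x ∈ AddSubmonoid.closure (P.root '' b.support), ∃ f : ι → ℕ,
      x = ∑ j ∈ b.support, (f j : ℤ) • P.root j := by
    intro x hx
    induction hx using AddSubmonoid.closure_induction with
    | mem x hx =>
      classical
      obtain ⟨j, hj, rfl⟩ := hx
      refine ⟨Pi.single j 1, ?_⟩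
      rw [Finset.sum_eq_single_of_mem j hj]
      · simp
      · intro k _ hk
        simp [hk]
    | zero => exact ⟨0, by simp⟩
    | add x y _ _ hx hy =>
      obtain ⟨f, rfl⟩ := hx
      obtain ⟨g, rfl⟩ := hy
      exact ⟨f + g, by simp [add_smul, Finset.sum_add_distrib]⟩
  obtain ⟨f, hf⟩ := key _ hk
  obtain ⟨g, -, -, hg⟩ := b.exists_root_eq_sum_int i
  have hk' : P.root k = ∑ j ∈ b.support, (fun j => g j + f j) j • P.root j := by
    rw [← sub_add_cancel (P.root k) (P.root i), hf, hg, add_comm, ← Finset.sum_add_distrib]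
    exact Finset.sum_congr rfl fun j _ => by rw [add_smul]
  rw [Base.height_eq_sum hk', Base.height_eq_sum hg, Finset.sum_add_distrib] at h1
  have h2 : ∑ j ∈ b.support, (f j : ℤ) = 0 :=
    le_antisymm (by linarith) (Finset.sum_nonneg fun j _ => by positivity)
  rw [Finset.sum_eq_zero_iff_of_nonneg (fun j _ => by positivity)] at h2
  apply hne
  apply P.root.injective
  rw [← sub_eq_zero, hf]
  exact Finset.sum_eq_zero fun j hj => by rw [h2 j hj, zero_smul]

variable {b}

omit [Finite ι] in
theorem IsMaximalRoot.isPos {i : ι} (hi : IsMaximalRoot b i) : b.IsPos i := by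
  by_contra h
  have h1 := root_mem_closure_of_isPos b ((isPos_negIdx b).mpr h)
  have h2 : negIdx P i = i := hi _ (by
    have := add_mem h1 h1
    simpa [sub_eq_add_neg] using this)
  exact h (by rw [← h2]; exact (isPos_negIdx b).mpr h)

variable [P.IsCrystallographic]

theorem IsMaximalRoot.pairingIn_nonneg {i j : ι} (hi : IsMaximalRoot b i) (hj : j ∈ b.support) :
    0 ≤ P.pairingIn ℤ i j := by
  by_contra! h
  have hne : P.root i ≠ -P.root j := by
    intro h'
    have h1 : i = negIdx P j := P.root.injective (by rw [h', root_negIdx])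
    exact (isPos_negIdx b).mp (h1 ▸ hi.isPos) (Base.isPos_of_mem_support hj)
  obtain ⟨k, hk⟩ := P.root_add_root_mem_of_pairingIn_neg h hne
  have := hi k (by rw [hk, add_sub_cancel_left]; exact AddSubmonoid.subset_closure ⟨j, hj, rfl⟩)
  rw [this, left_eq_add] at hk
  exact P.ne_zero j hk

variable [P.IsReduced] [P.IsIrreducible] [P.IsRootSystem]

/-- Irreducibility makes every simple root occur in a maximal root: the simple roots that occur span
a subspace stable under all simple reflections. Hence two maximal roots pair positively. If they
differed, their difference would be a root, and its sign would contradict the maximality of one of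
them. -/
theorem IsMaximalRoot.eq {i i' : ι} (hi : IsMaximalRoot b i) (hi' : IsMaximalRoot b i') :
    i = i' := by
  obtain ⟨f, hfs, hf | hf⟩ := b.exists_root_eq_sum_nat_or_neg i
  swap
  · exfalso
    refine (isPos_negIdx b).mp ?_ hi.isPos
    have h1 : P.root (negIdx P i) = ∑ j ∈ b.support, (fun j => (f j : ℤ)) j • P.root j := by
      rw [root_negIdx, hf, _root_.neg_neg]
      exact Finset.sum_congr rfl fun j _ => by simp
    rw [Base.isPos_iff', Base.height_eq_sum h1]
    exact Finset.sum_nonneg fun j _ => by positivity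
  have hsum : ∀ k, P.pairingIn ℤ i k = ∑ j ∈ b.support, (f j : ℤ) * P.pairingIn ℤ j k := by
    intro k
    apply FaithfulSMul.algebraMap_injective ℤ ℝ
    simp_rw [map_sum, map_mul, algebraMap_pairingIn, ← root_coroot_eq_pairing, hf, map_sum,
      LinearMap.sum_apply]
    exact Finset.sum_congr rfl fun j _ => by simp
  have hpos : ∀ j ∈ b.support, f j ≠ 0 := by
    -- The pairing of the maximal root with a simple coroot outside its support is nonnegative by
    -- maximality, yet a sum of nonpositive terms; so each term vanishes.
    have hort : ∀ k ∈ b.support, f k = 0 → ∀ j ∈ b.support, f j ≠ 0 → P.pairingIn ℤ j k = 0 := by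
      intro k hk hfk j hj hfj
      have h1 := hi.pairingIn_nonneg hk
      rw [hsum] at h1
      have hle : ∀ l ∈ b.support, (f l : ℤ) * P.pairingIn ℤ l k ≤ 0 := by
        intro l hl
        rcases eq_or_ne l k with rfl | hlk
        · simp [hfk]
        · exact mul_nonpos_of_nonneg_of_nonpos (by positivity)
            (b.pairingIn_le_zero_of_ne hlk hl hk)
      have h2 := (Finset.sum_eq_zero_iff_of_nonpos hle).mp
        (le_antisymm (Finset.sum_nonpos hle) h1) j hj
      simpa [hfj] using h2
    set q : Submodule ℝ M := Submodule.span ℝ (P.root '' {j | j ∈ b.support ∧ f j ≠ 0}) with hq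
    have hinv : ∀ k, q ∈ Module.End.invtSubmodule (P.reflection k : M →ₗ[ℝ] M) := by
      apply (b.forall_mem_support_invtSubmodule_iff q).mp
      intro k hk
      rw [Module.End.mem_invtSubmodule]
      conv_lhs => rw [hq]
      rw [Submodule.span_le]
      rintro - ⟨j, ⟨hj, hfj⟩, rfl⟩
      change P.reflection k (P.root j) ∈ q
      rw [P.reflection_apply_root' ℤ]
      by_cases hfk : f k = 0
      · rw [hort k hk hfk j hj hfj, zero_smul, sub_zero]
        exact Submodule.subset_span ⟨j, ⟨hj, hfj⟩, rfl⟩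
      · have hjq : P.root j ∈ q := Submodule.subset_span ⟨j, ⟨hj, hfj⟩, rfl⟩
        have hkq : P.root k ∈ q := Submodule.subset_span ⟨k, ⟨hk, hfk⟩, rfl⟩
        exact sub_mem hjq (zsmul_mem hkq _)
    have hmem : P.root i ∈ q := by
      rw [hf]
      refine Submodule.sum_mem q fun j hj => ?_
      by_cases hfj : f j = 0
      · rw [hfj, zero_smul]; exact zero_mem _
      · have h1 : P.root j ∈ q := Submodule.subset_span ⟨j, ⟨hj, hfj⟩, rfl⟩
        exact nsmul_mem h1 _
    have htop : q = ⊤ := IsIrreducible.eq_top_of_invtSubmodule_reflection q hinv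
      (fun h => P.ne_zero i (by rw [h] at hmem; simpa using hmem))
    intro j hj hfj
    have hle : q ≤ LinearMap.ker (b.toWeightBasis.coord ⟨j, hj⟩) := by
      rw [hq, Submodule.span_le]
      rintro - ⟨l, ⟨hl, hfl⟩, rfl⟩
      have h1 := b.toWeightBasis_repr_root ⟨l, hl⟩
      have hne : l ≠ j := by rintro rfl; exact hfl hfj
      simp only at h1
      simp [h1, hne]
    have h1 := b.toWeightBasis_repr_root ⟨j, hj⟩
    have h2 : P.root j ∈ LinearMap.ker (b.toWeightBasis.coord ⟨j, hj⟩) :=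
      hle (htop ▸ Submodule.mem_top)
    simp only at h1
    simp [h1] at h2
  obtain ⟨j, hj, hjpos⟩ := hi'.isPos.exists_mem_support_pos_pairingIn
  have hlt : 0 < P.pairingIn ℤ i i' := by
    rw [hsum]
    refine Finset.sum_pos' (fun k hk => mul_nonneg (by positivity) ?_) ⟨j, hj, ?_⟩
    · have := hi'.pairingIn_nonneg hk
      rcases this.eq_or_lt with h | h
      · rw [eq_comm, P.pairingIn_eq_zero_iff] at h
        exact h.ge
      · exact ((P.zero_lt_pairingIn_iff' ℤ).mp h).le
    · have := Nat.pos_of_ne_zero (hpos j hj)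
      positivity
  by_contra hne
  obtain ⟨k, hk⟩ := P.root_sub_root_mem_of_pairingIn_pos hlt hne
  by_cases hkp : b.IsPos k
  · exact hne (hi' i (by rw [← hk]; exact root_mem_closure_of_isPos b hkp))
  · refine hne (hi i' ?_).symm
    have := root_mem_closure_of_isPos b ((isPos_negIdx b).mpr hkp)
    rwa [root_negIdx, hk, neg_sub] at this

variable (b)

theorem exists_isHighestRoot : ∃ i, IsHighestRoot b i := by
  have : Nontrivial M := IsIrreducible.nontrivial P
  have : Nonempty ι := by
    by_contra h
    rw [not_nonempty_iff] at h
    have h1 := IsRootSystem.span_root_eq_top (P := P)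
    rw [Set.range_eq_empty, Submodule.span_empty] at h1
    exact bot_ne_top h1
  obtain ⟨i, hi, -⟩ := exists_isMaximalRoot_above b (Classical.arbitrary ι)
  refine ⟨i, fun j => ?_⟩
  obtain ⟨i', hi', hj⟩ := exists_isMaximalRoot_above b j
  rwa [hi.eq hi']

end Height

end ExtAffine

end

noncomputable section

namespace ExtAffine

open RootPairing

variable {ι M N : Type*} [Fintype ι] [AddCommGroup M] [Module ℝ M] [AddCommGroup N] [Module ℝ N]
  {P : RootPairing ι ℝ M N}

/-! ### Positive affine roots -/

section Positive

variable (b : P.Base)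

open Classical in
/-- The smallest constant term of a positive affine root with the given gradient. -/
def minLevel (i : ι) : ℤ := if b.IsPos i then 1 else 0

/-- An affine root is positive if it takes positive values on the base alcove
`{v | -1 < ⟨v, α⟩ < 0 for all positive roots α}`. -/
def AffRoot.IsPos (a : AffRoot ι) : Prop := minLevel b a.idx ≤ a.lvl

/-- A strict bound for the heights of all roots. -/
def heightBound : ℤ := 1 + ∑ i, |b.height i|

/-- The value of an affine root at a point of the base alcove, up to a factor. -/
def affHeight (a : AffRoot ι) : ℤ := heightBound b * a.lvl - b.height a.idx

theorem abs_height_lt (i : ι) : |b.height i| < heightBound b := by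
  have := Finset.single_le_sum (f := fun i => |b.height i|) (fun i _ => abs_nonneg _)
    (Finset.mem_univ i)
  simp only [heightBound]
  linarith

theorem heightBound_pos : 0 < heightBound b := by
  have : 0 ≤ ∑ i, |b.height i| := Finset.sum_nonneg fun i _ => abs_nonneg _
  simp only [heightBound]
  linarith

variable {b}

omit [Fintype ι] in
theorem minLevel_of_isPos {i : ι} (h : b.IsPos i) : minLevel b i = 1 := if_pos h

omit [Fintype ι] in
theorem minLevel_of_not_isPos {i : ι} (h : ¬ b.IsPos i) : minLevel b i = 0 := if_neg h

/-- Positivity becomes the sign of one additive function, the value at an interior point of the base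
alcove. Later sign arguments are then linear arithmetic. -/
theorem affRoot_isPos_iff {a : AffRoot ι} : a.IsPos b ↔ 0 < affHeight b a := by
  have h1 := abs_lt.mp (abs_height_lt b a.idx)
  have h2 := heightBound_pos b
  have h3 := b.height_ne_zero a.idx
  rw [AffRoot.IsPos, affHeight]
  by_cases h : b.IsPos a.idx
  · rw [minLevel_of_isPos h]
    rw [Base.isPos_iff] at h
    constructor
    · intro h'; nlinarith
    · intro h'; by_contra! hc
      have : a.lvl ≤ 0 := by linarith
      nlinarith
  · rw [minLevel_of_not_isPos h]
    rw [Base.isPos_iff] at h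
    constructor
    · intro h'
      have : b.height a.idx < 0 := lt_of_le_of_ne (not_lt.mp h) h3
      nlinarith
    · intro h'; by_contra! hc
      have : a.lvl ≤ -1 := by linarith
      nlinarith

@[simp] theorem affHeight_neg (a : AffRoot ι) :
    affHeight b (AffRoot.neg P a) = -affHeight b a := by
  simp only [affHeight, AffRoot.neg, height_negIdx]
  ring

theorem affHeight_ne_zero (a : AffRoot ι) : affHeight b a ≠ 0 := by
  have h1 := abs_lt.mp (abs_height_lt b a.idx)
  have h3 := b.height_ne_zero a.idx
  rw [affHeight]
  intro h
  rcases lt_trichotomy a.lvl 0 with h2 | h2 | h2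
  · have : a.lvl ≤ -1 := by linarith
    nlinarith [heightBound_pos b]
  · rw [h2] at h
    apply h3
    linarith
  · have : 1 ≤ a.lvl := by linarith
    nlinarith [heightBound_pos b]

theorem not_affRoot_isPos_iff {a : AffRoot ι} : ¬ a.IsPos b ↔ affHeight b a < 0 := by
  rw [affRoot_isPos_iff, not_lt]
  exact ⟨fun h => lt_of_le_of_ne h (affHeight_ne_zero a), le_of_lt⟩

theorem affRoot_neg_isPos_iff {a : AffRoot ι} : (AffRoot.neg P a).IsPos b ↔ ¬ a.IsPos b := by
  rw [not_affRoot_isPos_iff, affRoot_isPos_iff, affHeight_neg]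
  exact neg_pos

theorem affHeight_smul_affReflection [P.IsCrystallographic] (z : ExtAffineWeyl P)
    (a c : AffRoot ι) :
    affHeight b (z • affReflection P a • c) =
      affHeight b (z • c) - P.pairingIn ℤ c.idx a.idx * affHeight b (z • a) := by
  have h1 := root_smul_reflectionPerm z.right c.idx a.idx
  have h2 := pair_of_root_eq_sub_zsmul (χ := Multiplicative.toAdd z.left) h1
  have h3 := b.height_add_zsmul (z := -P.pairingIn ℤ c.idx a.idx)
    (h1.trans (by rw [neg_smul, sub_eq_add_neg]))
  rw [affReflection_smul]
  simp only [affHeight, smul_idx, smul_lvl, h2, h3, smul_eq_mul]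
  ring

theorem affHeight_affReflection [P.IsCrystallographic] (a c : AffRoot ι) :
    affHeight b (affReflection P a • c) =
      affHeight b c - P.pairingIn ℤ c.idx a.idx * affHeight b a := by
  simpa using affHeight_smul_affReflection (b := b) 1 a c

end Positive

/-! ### The length function counts inversions -/

section Length

variable (b : P.Base)

/-- The positive affine roots `a` for which `z⁻¹ a` is negative. -/
def inversions (z : ExtAffineWeyl P) : Set (AffRoot ι) :=
  {a | a.IsPos b ∧ ¬ (z⁻¹ • a).IsPos b}

theorem sum_eq_sum_isPos {A : Type*} [AddCommMonoid A] (f : ι → A) :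
    ∑ i, f i = by classical exact ∑ i with b.IsPos i, (f i + f (negIdx P i)) := by
  classical
  rw [Finset.sum_add_distrib, ← Finset.sum_filter_add_sum_filter_not _ (fun i => b.IsPos i)]
  congr 1
  refine Finset.sum_bij' (fun i _ => negIdx P i) (fun i _ => negIdx P i) ?_ ?_ ?_ ?_ ?_
  · intro i hi
    simpa [isPos_negIdx] using hi
  · intro i hi
    simpa [isPos_negIdx] using hi
  · simp
  · simp
  · simp

/-- For a fixed gradient, the constant terms of the inversions form an integer interval. This gives
finiteness and allows counting. -/
theorem inversions_eq_image (z : ExtAffineWeyl P) :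
    inversions b z = (fun p : (_ : ι) × ℤ => AffRoot.mk p.1 p.2) ''
      (Finset.univ.sigma fun i => Finset.Ico (minLevel b i)
        (minLevel b (z.right⁻¹ • i) - pair (Multiplicative.toAdd z.left) i) : Finset _) := by
  ext a
  simp only [inversions, Set.mem_ofPred_eq, Set.mem_image, Finset.mem_coe, Finset.mem_sigma,
    Finset.mem_univ, true_and, Finset.mem_Ico, AffRoot.IsPos, inv_smul_idx, inv_smul_lvl, not_le]
  constructor
  · rintro ⟨h1, h2⟩
    exact ⟨⟨a.idx, a.lvl⟩, ⟨h1, by linarith⟩, rfl⟩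
  · rintro ⟨p, ⟨h1, h2⟩, rfl⟩
    exact ⟨h1, by linarith⟩

theorem finite_inversions (z : ExtAffineWeyl P) : (inversions b z).Finite := by
  rw [inversions_eq_image]
  exact (Finset.finite_toSet _).image _

/-- Pair each positive root with its negative. With p = ⟨χ, α⟩, the two intervals of constant terms
have total size |p| if w⁻¹α > 0 and |p + 1| if w⁻¹α < 0. -/
theorem length_eq_ncard (z : ExtAffineWeyl P) : length b z = (inversions b z).ncard := by
  rw [inversions_eq_image, Set.ncard_image_of_injective, Set.ncard_coe_finset, Finset.card_sigma,
    sum_eq_sum_isPos b, length]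
  · refine Finset.sum_congr (by congr) fun i hi => ?_
    have hi : b.IsPos i := by simpa using hi
    simp only [Int.card_Ico, pair_negIdx, smul_negIdx, minLevel_of_isPos hi,
      minLevel_of_not_isPos (mt (isPos_negIdx b).mp (not_not.mpr hi))]
    by_cases h : b.IsPos (z.right⁻¹ • i)
    · rw [if_pos h, minLevel_of_isPos h,
        minLevel_of_not_isPos (mt (isPos_negIdx b).mp (not_not.mpr h))]
      omega
    · rw [if_neg h, minLevel_of_not_isPos h, minLevel_of_isPos ((isPos_negIdx b).mpr h)]
      omega
  · rintro ⟨i, k⟩ ⟨j, l⟩ h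
    simp only [AffRoot.mk.injEq] at h
    obtain ⟨rfl, rfl⟩ := h
    rfl

theorem length_finIncl_le (w : P.weylGroup) : length b (finIncl P w) ≤ Fintype.card ι := by
  classical
  refine (Finset.sum_le_card_nsmul _ _ 1 fun i _ => ?_).trans ?_
  · change (if _ then (pair (0 : coweightLattice P) i).natAbs
      else (pair (0 : coweightLattice P) i + 1).natAbs) ≤ 1
    split_ifs <;> simp
  · rw [smul_eq_mul, mul_one]
    exact Finset.card_le_univ _

variable [P.IsCrystallographic] [P.IsRootSystem]

variable {b}

/-- With r the reflection in a, send an inversion c of z to r c if that is positive and to c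
otherwise. This injects the inversions of z into those of r z, and a is an inversion of r z outside
the image. -/
theorem length_lt_length_affReflection_mul {z : ExtAffineWeyl P} {a : AffRoot ι}
    (ha : a.IsPos b) (hz : (z⁻¹ • a).IsPos b) : length b z < length b (affReflection P a * z) := by
  classical
  rw [length_eq_ncard, length_eq_ncard]
  set r := affReflection P a with hr
  have hrr : ∀ c : AffRoot ι, r • r • c = c := fun c => by
    rw [smul_smul, affReflection_mul_self, one_smul]
  have hinv : (r * z)⁻¹ = z⁻¹ * r := by rw [mul_inv_rev, affReflection_inv]
  let f : AffRoot ι → AffRoot ι := fun c => if (r • c).IsPos b then r • c else c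
  have hinj : Set.InjOn f (inversions b z) := by
    intro c hc d hd h
    have hc1 := hc.1
    have hd1 := hd.1
    simp only [f] at h
    split_ifs at h with h1 h2 h2
    · exact MulAction.injective r h
    · rw [← h, hrr] at h2; exact absurd hc1 h2
    · rw [h, hrr] at h1; exact absurd hd1 h1
    · exact h
  rw [← hinj.ncard_image]
  apply Set.ncard_lt_ncard _ (finite_inversions b _)
  rw [Set.ssubset_iff_of_subset]
  · refine ⟨a, ⟨ha, ?_⟩, ?_⟩
    · rw [hinv, mul_smul, hr, affReflection_smul_self, smul_affRoot_neg, affRoot_neg_isPos_iff,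
        not_not]
      exact hz
    · rintro ⟨c, ⟨hc1, hc2⟩, hc⟩
      simp only [f] at hc
      split_ifs at hc with h1
      · have h2 := hrr c
        rw [hc, hr, affReflection_smul_self] at h2
        rw [← h2, affRoot_neg_isPos_iff] at hc1
        exact hc1 ha
      · rw [hc] at hc2
        exact hc2 hz
  · rintro - ⟨c, ⟨hc1, hc2⟩, rfl⟩
    simp only [f]
    split_ifs with h1
    · refine ⟨h1, ?_⟩
      rw [hinv, mul_smul, hrr]
      exact hc2
    · refine ⟨hc1, ?_⟩
      rw [hinv, mul_smul]
      rw [not_affRoot_isPos_iff] at *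
      rw [affRoot_isPos_iff] at *
      rw [affHeight_affReflection] at h1
      rw [affHeight_smul_affReflection]
      -- As c and a are positive and r c is negative, c pairs positively with the coroot of a; then
      -- z⁻¹ r c is the negative z⁻¹ c minus a positive multiple of the positive z⁻¹ a.
      have hn : 0 < P.pairingIn ℤ c.idx a.idx := by
        by_contra! hn
        nlinarith
      nlinarith

theorem length_lt_length_mul_affReflection {z : ExtAffineWeyl P} {a : AffRoot ι}
    (ha : a.IsPos b) (hz : (z • a).IsPos b) : length b z < length b (z * affReflection P a) := by
  have h := length_lt_length_affReflection_mul (b := b) (z := z) (a := z • a) hz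
    (by rwa [inv_smul_smul])
  rwa [affReflection_smul_root, inv_mul_cancel_right] at h

theorem length_mul_affReflection_lt {z : ExtAffineWeyl P} {a : AffRoot ι}
    (ha : a.IsPos b) (hz : ¬ (z • a).IsPos b) :
    length b (z * affReflection P a) < length b z := by
  have h := length_lt_length_mul_affReflection (b := b) (z := z * affReflection P a) ha (by
    rw [mul_smul, affReflection_smul_self, smul_affRoot_neg]
    exact affRoot_neg_isPos_iff.mpr hz)
  rwa [mul_assoc, affReflection_mul_self, mul_one] at h

theorem length_lt_mul_affReflection_iff {z : ExtAffineWeyl P} {a : AffRoot ι}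
    (ha : a.IsPos b) :
    length b z < length b (z * affReflection P a) ↔ (z • a).IsPos b :=
  ⟨fun h => by
    by_contra h'
    exact lt_asymm h (length_mul_affReflection_lt ha h'), length_lt_length_mul_affReflection ha⟩

end Length

/-! ### Simple affine roots -/

section Simple

variable (b : P.Base)

/-- The affine roots whose hyperplanes bound the base alcove. -/
def AffRoot.IsSimple (a : AffRoot ι) : Prop :=
  (∃ i ∈ b.support, a = ⟨negIdx P i, 0⟩) ∨ ∃ i, IsHighestRoot b i ∧ a = ⟨i, 1⟩

variable {b}

omit [Fintype ι] in
theorem IsHighestRoot.height_le [P.IsRootSystem] {i : ι} (hi : IsHighestRoot b i) (j : ι) :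
    b.height j ≤ b.height i := by
  have h := nonneg_of_mem_closure b (f := heightFunctional b) (fun k hk => by
    rw [heightFunctional_root, Base.height_one_of_mem_support hk]; simp) (hi j)
  rw [map_sub, heightFunctional_root, heightFunctional_root, sub_nonneg] at h
  exact_mod_cast h

omit [Fintype ι] in
theorem IsHighestRoot.isPos [P.IsRootSystem] {i : ι} (hi : IsHighestRoot b i) : b.IsPos i := by
  have := hi.height_le (negIdx P i)
  rw [height_negIdx] at this
  rw [Base.isPos_iff']
  linarith

omit [Fintype ι] in
theorem affRoot_isPos_of_isSimple [P.IsRootSystem] {a : AffRoot ι} (ha : a.IsSimple b) :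
    a.IsPos b := by
  rcases ha with ⟨i, hi, rfl⟩ | ⟨i, hi, rfl⟩
  · rw [AffRoot.IsPos, minLevel_of_not_isPos]
    rw [isPos_negIdx, not_not]
    exact Base.isPos_of_mem_support hi
  · rw [AffRoot.IsPos, minLevel_of_isPos hi.isPos]

variable [P.IsCrystallographic]

omit [Fintype ι] in
theorem root_reflectionPerm_eq (i j : ι) :
    P.root (P.reflectionPerm i j) = P.root j - P.pairingIn ℤ j i • P.root i := by
  rw [root_reflectionPerm, reflection_apply_root' ℤ]

omit [Fintype ι] in
theorem height_reflectionPerm (i j : ι) :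
    b.height (P.reflectionPerm i j) = b.height j - P.pairingIn ℤ j i * b.height i := by
  have := b.height_add_zsmul (z := -P.pairingIn ℤ j i)
    ((root_reflectionPerm_eq i j).trans (by rw [neg_smul, sub_eq_add_neg]))
  rw [this, smul_eq_mul]
  ring

/-- The reflection of α_j in the highest root has height ht(α_j) - n ht(θ), which must lie between
-ht(θ) and ht(θ); this excludes n < 0 and n ≥ 2. -/
theorem IsHighestRoot.pairingIn_mem [P.IsRootSystem] {i j : ι}
    (hi : IsHighestRoot b i) (hj : b.IsPos j) (hij : j ≠ i) :
    P.pairingIn ℤ j i = 0 ∨ P.pairingIn ℤ j i = 1 := by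
  have h1 := height_reflectionPerm (b := b) i j
  have h2 := hi.height_le (P.reflectionPerm i j)
  have h3 := hi.height_le (negIdx P (P.reflectionPerm i j))
  have h4 := hi.isPos
  rw [Base.isPos_iff] at hj h4
  rw [height_negIdx] at h3
  rw [h1] at h2 h3
  have h5 : 0 ≤ P.pairingIn ℤ j i := by
    by_contra! h
    have : P.pairingIn ℤ j i ≤ -1 := by linarith
    nlinarith
  by_contra! hn
  have h6 : 2 ≤ P.pairingIn ℤ j i := by omega
  -- The height bound alone leaves ht(α_j) = ht(θ). Since α_j - θ is a root, its height is nonzero,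
  -- so this case is excluded as well.
  obtain ⟨k, hk⟩ := P.root_sub_root_mem_of_pairingIn_pos (by linarith) hij
  have h7 := b.height_sub hk
  have h8 := b.height_ne_zero k
  have h9 := hi.height_le j
  have h10 : b.height j < b.height i := by omega
  nlinarith

/-- A simple affine reflection permutes the positive affine roots other than its own. For the finite
ones this is the classical fact about simple reflections; for s_0 it follows from the pairings with
θ^∨ being 0 or 1. -/
theorem affReflection_smul_isPos [P.IsRootSystem] [P.IsReduced] {a c : AffRoot ι}
    (ha : a.IsSimple b) (hc : c.IsPos b) (hac : c ≠ a) : (affReflection P a • c).IsPos b := by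
  obtain ⟨j, m⟩ := c
  rcases ha with ⟨i, hi, rfl⟩ | ⟨i, hi, rfl⟩
  · have : (⟨negIdx P i, 0⟩ : AffRoot ι) = AffRoot.neg P ⟨i, 0⟩ := by simp [AffRoot.neg]
    rw [this, affReflection_neg, affReflection_smul]
    simp only [AffRoot.IsPos, mul_zero, sub_zero] at *
    by_cases hj : b.IsPos j
    · rw [minLevel_of_isPos hj] at hc
      refine le_trans ?_ hc
      rw [minLevel]
      split_ifs <;> simp
    · rw [minLevel_of_not_isPos hj] at hc
      by_cases hm : m = 0
      · subst hm
        rw [minLevel_of_not_isPos]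
        have hne : negIdx P j ≠ i := by
          rintro rfl
          simp at hac
        have := Base.IsPos.reflectionPerm ((isPos_negIdx b).mpr hj) hi hne
        rwa [reflectionPerm_negIdx, isPos_negIdx] at this
      · refine le_trans (b := 1) ?_ (by omega)
        rw [minLevel]
        split_ifs <;> simp
  · rw [affReflection_smul]
    simp only [AffRoot.IsPos, mul_one] at *
    have hle : ∀ k, minLevel b k ≤ 1 := fun k => by rw [minLevel]; split_ifs <;> simp
    have hzero : P.pairingIn ℤ j i = 0 → P.reflectionPerm i j = j := fun h =>
      P.root.injective (by rw [root_reflectionPerm_eq, h, zero_smul, sub_zero])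
    by_cases hj : b.IsPos j
    · rw [minLevel_of_isPos hj] at hc
      by_cases hji : j = i
      · subst hji
        have hm : m ≠ 1 := fun h => hac (by rw [h])
        have := minLevel_of_not_isPos (mt (isPos_negIdx b).mp (not_not.mpr hj))
        rw [negIdx] at this
        rw [this, pairingIn_same]
        omega
      · rcases hi.pairingIn_mem hj hji with h | h
        · rw [hzero h, h, minLevel_of_isPos hj]
          omega
        · rw [h, minLevel_of_not_isPos]
          · omega
          · rw [Base.isPos_iff, height_reflectionPerm, h]
            have := hi.height_le j
            linarith
    · rw [minLevel_of_not_isPos hj] at hc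
      have hj' := (isPos_negIdx b).mpr hj
      have hneg : P.pairingIn ℤ (negIdx P j) i = -P.pairingIn ℤ j i := by
        rw [negIdx, pairingIn_reflectionPerm_self_left]
      by_cases hji : negIdx P j = i
      · have : P.pairingIn ℤ j i = -2 := by
          rw [hji, pairingIn_same] at hneg
          linarith
        have := hle (P.reflectionPerm i j)
        omega
      · rcases hi.pairingIn_mem hj' hji with h | h
        · have h0 : P.pairingIn ℤ j i = 0 := by linarith
          rw [hzero h0, h0, minLevel_of_not_isPos hj]
          omega
        · have := hle (P.reflectionPerm i j)
          omega

theorem eq_of_not_affReflection_smul_isPos [P.IsRootSystem] [P.IsReduced] {a c : AffRoot ι}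
    (ha : a.IsSimple b) (hc : c.IsPos b) (hac : ¬ (affReflection P a • c).IsPos b) : c = a := by
  by_contra h
  exact hac (affReflection_smul_isPos ha hc h)

variable [P.IsRootSystem] [P.IsReduced]

theorem length_mul_simple_of_isPos {z : ExtAffineWeyl P} {a : AffRoot ι} (ha : a.IsSimple b)
    (hz : (z • a).IsPos b) : length b (z * affReflection P a) = length b z + 1 := by
  refine le_antisymm ?_ (length_lt_length_mul_affReflection (affRoot_isPos_of_isSimple ha) hz)
  rw [length_eq_ncard, length_eq_ncard]
  have hsub : inversions b (z * affReflection P a) ⊆ insert (z • a) (inversions b z) := by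
    rintro c ⟨hc1, hc2⟩
    rw [mul_inv_rev, affReflection_inv, mul_smul] at hc2
    by_cases h : (z⁻¹ • c).IsPos b
    · left
      rw [← eq_of_not_affReflection_smul_isPos ha h hc2, smul_inv_smul]
    · exact Or.inr ⟨hc1, h⟩
  exact (Set.ncard_le_ncard hsub ((finite_inversions b z).insert _)).trans
    (Set.ncard_insert_le _ _)

theorem length_mul_simple_of_not_isPos {z : ExtAffineWeyl P} {a : AffRoot ι}
    (ha : a.IsSimple b) (hz : ¬ (z • a).IsPos b) :
    length b z = length b (z * affReflection P a) + 1 := by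
  have h := length_mul_simple_of_isPos (z := z * affReflection P a) ha (by
    rw [mul_smul, affReflection_smul_self, smul_affRoot_neg]
    exact affRoot_neg_isPos_iff.mpr hz)
  rwa [mul_assoc, affReflection_mul_self, mul_one] at h

/-- A positive affine root is a nonnegative combination of simple ones: α + m is (θ + 1) + (α - θ) +
(m - 1) for positive α, with α - θ a sum of negative simple roots. Linearity of the height in the
gradient gives a value ≥ 0, and it is never zero. -/
theorem smul_isPos_of_forall_simple [P.IsIrreducible] {z : ExtAffineWeyl P}
    (hz : ∀ a : AffRoot ι, a.IsSimple b → (z • a).IsPos b) {c : AffRoot ι} (hc : c.IsPos b) :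
    (z • c).IsPos b := by
  -- The gradient part of `affHeight` after applying z, as a linear functional on M.
  let F : M →ₗ[ℝ] ℝ :=
    -(((heightBound b : ℝ) • P.toLinearMap.flip (Multiplicative.toAdd z.left : coweightLattice P) +
      heightFunctional b) ∘ₗ (Equiv.weightHom P z.right.1 : M →ₗ[ℝ] M))
  have hF : ∀ i, ∀ k : ℤ, (affHeight b (z • (⟨i, k⟩ : AffRoot ι)) : ℝ) =
      heightBound b * k + F (P.root i) := by
    intro i k
    have h1 : Equiv.weightHom P z.right.1 (P.root i) = P.root (z.right • i) :=
      (root_weylGroup_smul _ _).symm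
    have h2 := pair_spec (Multiplicative.toAdd z.left : coweightLattice P) (z.right • i)
    simp only [F, LinearMap.neg_apply, LinearMap.comp_apply, LinearEquiv.coe_coe, h1,
      LinearMap.add_apply, LinearMap.smul_apply, heightFunctional_root, affHeight, smul_idx,
      smul_lvl]
    push_cast
    rw [← h2]
    simp only [RootPairing.root', LinearMap.flip_apply, smul_eq_mul]
    ring
  obtain ⟨θ, hθ⟩ := exists_isHighestRoot b
  have hs : ∀ j ∈ b.support, 0 ≤ (-F) (P.root j) := by
    intro j hj
    have h1 := affRoot_isPos_iff.mp (hz _ (Or.inl ⟨j, hj, rfl⟩))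
    have h2 := hF (negIdx P j) 0
    rw [root_negIdx, map_neg] at h2
    have h3 : (0 : ℝ) < (affHeight b (z • (⟨negIdx P j, 0⟩ : AffRoot ι)) : ℝ) := by
      exact_mod_cast h1
    rw [h2] at h3
    rw [LinearMap.neg_apply]
    simp only [Int.cast_zero, mul_zero, zero_add] at h3
    exact h3.le
  have hB : (0 : ℝ) < heightBound b := by exact_mod_cast heightBound_pos b
  obtain ⟨j, m⟩ := c
  have hnn : (0 : ℝ) ≤ affHeight b (z • (⟨j, m⟩ : AffRoot ι)) := by
    rw [hF]
    by_cases hj : b.IsPos j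
    · rw [AffRoot.IsPos, minLevel_of_isPos hj] at hc
      have h1 := nonneg_of_mem_closure b hs (hθ j)
      have h2 : (0 : ℝ) < (affHeight b (z • (⟨θ, 1⟩ : AffRoot ι)) : ℝ) := by
        exact_mod_cast affRoot_isPos_iff.mp (hz _ (Or.inr ⟨θ, hθ, rfl⟩))
      rw [hF] at h2
      rw [LinearMap.neg_apply, map_sub] at h1
      push_cast at h2
      have h3 : (1 : ℝ) ≤ m := by exact_mod_cast hc
      nlinarith
    · rw [AffRoot.IsPos, minLevel_of_not_isPos hj] at hc
      have h1 := nonneg_of_mem_closure b hs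
        (root_mem_closure_of_isPos b ((isPos_negIdx b).mpr hj))
      rw [root_negIdx, LinearMap.neg_apply, map_neg] at h1
      have h3 : (0 : ℝ) ≤ m := by exact_mod_cast hc
      have := mul_nonneg hB.le h3
      linarith
  rw [affRoot_isPos_iff]
  exact lt_of_le_of_ne (by exact_mod_cast hnn) (affHeight_ne_zero _).symm

theorem exists_simple_descent [P.IsIrreducible] {z : ExtAffineWeyl P} (hz : length b z ≠ 0) :
    ∃ a : AffRoot ι, a.IsSimple b ∧ ¬ (z • a).IsPos b := by
  by_contra! h
  apply hz
  rw [length_eq_ncard, Set.ncard_eq_zero (finite_inversions b z), Set.eq_empty_iff_forall_notMem]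
  rintro c ⟨hc1, hc2⟩
  have h1 := smul_isPos_of_forall_simple h
    (affRoot_neg_isPos_iff.mpr hc2 : (AffRoot.neg P (z⁻¹ • c)).IsPos b)
  rw [smul_affRoot_neg, smul_inv_smul, affRoot_neg_isPos_iff] at h1
  exact h1 hc1

omit [P.IsCrystallographic] [P.IsRootSystem] [P.IsReduced] in
theorem smul_isPos_iff_of_length_eq_zero {z : ExtAffineWeyl P} (hz : length b z = 0)
    {c : AffRoot ι} : (z • c).IsPos b ↔ c.IsPos b := by
  rw [length_eq_ncard, Set.ncard_eq_zero (finite_inversions b z),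
    Set.eq_empty_iff_forall_notMem] at hz
  have key : ∀ c : AffRoot ι, (z • c).IsPos b → c.IsPos b := by
    intro c hc
    by_contra h
    exact hz (z • c) ⟨hc, by rwa [inv_smul_smul]⟩
  refine ⟨key c, fun hc => ?_⟩
  by_contra h
  have h1 := key (AffRoot.neg P c) (by rwa [smul_affRoot_neg, affRoot_neg_isPos_iff])
  exact affRoot_neg_isPos_iff.mp h1 hc

end Simple

end ExtAffine

end

noncomputable section

namespace ExtAffine

open RootPairing

variable {ι M N : Type*} [Fintype ι] [AddCommGroup M] [Module ℝ M] [AddCommGroup N] [Module ℝ N]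
  {P : RootPairing ι ℝ M N} [P.IsCrystallographic]

/-! ### The Bruhat order in terms of affine reflections -/

section Bruhat

variable (b : P.Base)

/-- Right multiplication by an affine reflection that increases the length. -/
def BruhatStep (z z' : ExtAffineWeyl P) : Prop :=
  (∃ a, z' = z * affReflection P a) ∧ length b z < length b z'

/-- The order generated by the length-increasing right multiplications by affine reflections. -/
def affBruhatLE : ExtAffineWeyl P → ExtAffineWeyl P → Prop :=
  Relation.ReflTransGen (BruhatStep b)

variable {b}

theorem affBruhatLE.refl (z : ExtAffineWeyl P) : affBruhatLE b z z := Relation.ReflTransGen.refl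

theorem affBruhatLE.trans {x y z : ExtAffineWeyl P} (h : affBruhatLE b x y)
    (h' : affBruhatLE b y z) : affBruhatLE b x z := Relation.ReflTransGen.trans h h'

theorem BruhatStep.le {x y : ExtAffineWeyl P} (h : BruhatStep b x y) : affBruhatLE b x y :=
  Relation.ReflTransGen.single h

theorem affBruhatLE.length_le {x y : ExtAffineWeyl P} (h : affBruhatLE b x y) :
    length b x ≤ length b y := by
  induction h with
  | refl => rfl
  | tail _ h ih => exact ih.trans h.2.le

theorem affBruhatLE.eq_of_length_le {x y : ExtAffineWeyl P} (h : affBruhatLE b x y)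
    (hl : length b y ≤ length b x) : x = y := by
  rcases Relation.ReflTransGen.cases_tail h with rfl | ⟨c, hc, hcy⟩
  · rfl
  · have h1 := affBruhatLE.length_le (b := b) hc
    have h2 := hcy.2
    omega

theorem affBruhatLE.antisymm {x y : ExtAffineWeyl P} (h : affBruhatLE b x y)
    (h' : affBruhatLE b y x) : x = y := h.eq_of_length_le h'.length_le

theorem affBruhatLE.length_lt {x y : ExtAffineWeyl P} (h : affBruhatLE b x y) (hne : x ≠ y) :
    length b x < length b y := by
  by_contra! hl
  exact hne (h.eq_of_length_le hl)

variable [P.IsRootSystem]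

theorem BruhatStep.exists_isPos {x y : ExtAffineWeyl P} (h : BruhatStep b x y) :
    ∃ a : AffRoot ι, a.IsPos b ∧ (x • a).IsPos b ∧ y = x * affReflection P a := by
  obtain ⟨⟨a, rfl⟩, hl⟩ := h
  obtain ⟨c, hc, hca⟩ : ∃ c : AffRoot ι, c.IsPos b ∧ affReflection P c = affReflection P a := by
    by_cases ha : a.IsPos b
    · exact ⟨a, ha, rfl⟩
    · exact ⟨AffRoot.neg P a, affRoot_neg_isPos_iff.mpr ha, affReflection_neg a⟩
  rw [← hca] at hl
  exact ⟨c, hc, (length_lt_mul_affReflection_iff hc).mp hl, by rw [hca]⟩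

theorem bruhatStep_of_isPos {x : ExtAffineWeyl P} {a : AffRoot ι} (ha : a.IsPos b)
    (hx : (x • a).IsPos b) : BruhatStep b x (x * affReflection P a) :=
  ⟨⟨a, rfl⟩, length_lt_length_mul_affReflection ha hx⟩

variable [P.IsReduced]

/-- If y = x s_c and s = s_a is simple, then y s = (x s) s_{s c}. For c ≠ a the affine root s c is
still positive and x s maps it to the positive x c, so this is again a step. -/
theorem BruhatStep.mul_simple {x y : ExtAffineWeyl P} (h : BruhatStep b x y) {a : AffRoot ι}
    (ha : a.IsSimple b) : y = x * affReflection P a ∨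
      BruhatStep b (x * affReflection P a) (y * affReflection P a) := by
  obtain ⟨c, hc, hxc, rfl⟩ := h.exists_isPos
  by_cases hca : c = a
  · exact Or.inl (by rw [hca])
  · right
    have h1 := affReflection_smul_isPos ha hc hca
    have h2 := bruhatStep_of_isPos (b := b) (x := x * affReflection P a) h1 (by
      rwa [mul_smul, smul_smul (affReflection P a), affReflection_mul_self, one_smul])
    rwa [affReflection_smul_root, affReflection_inv, mul_assoc x, mul_assoc (affReflection P a),
      ← mul_assoc (affReflection P a) (affReflection P a), affReflection_mul_self, one_mul,
      ← mul_assoc] at h2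

/-- The lifting property of the Bruhat order, in a form that needs no descent hypothesis;
`affBruhatLE.le_mul_simple` is its companion on the larger side. -/
theorem affBruhatLE.mul_simple {x y : ExtAffineWeyl P} (h : affBruhatLE b x y) {a : AffRoot ι}
    (ha : a.IsSimple b) : affBruhatLE b (x * affReflection P a) y ∨
      affBruhatLE b (x * affReflection P a) (y * affReflection P a) := by
  induction h with
  | refl => exact Or.inr (.refl _)
  | tail hc hstep ih =>
    rcases ih with ih | ih
    · exact Or.inl (ih.trans hstep.le)
    · rcases hstep.mul_simple ha with h | h
      · left; rwa [h]
      · exact Or.inr (ih.trans h.le)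

theorem affBruhatLE.le_mul_simple {x y : ExtAffineWeyl P} (h : affBruhatLE b x y)
    {a : AffRoot ι} (ha : a.IsSimple b) : affBruhatLE b x (y * affReflection P a) ∨
      affBruhatLE b (x * affReflection P a) (y * affReflection P a) := by
  induction h using Relation.ReflTransGen.head_induction_on with
  | refl => exact Or.inr (.refl _)
  | head hstep hc ih =>
    rcases ih with ih | ih
    · exact Or.inl (hstep.le.trans ih)
    · rcases hstep.mul_simple ha with h | h
      · left
        rwa [h, mul_assoc, affReflection_mul_self, mul_one] at ih
      · exact Or.inr (h.le.trans ih)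

omit [P.IsReduced] in
theorem bruhatStep_mul_simple {x : ExtAffineWeyl P} {a : AffRoot ι} (ha : a.IsSimple b)
    (hx : ¬ (x • a).IsPos b) : BruhatStep b (x * affReflection P a) x :=
  ⟨⟨a, by rw [mul_assoc, affReflection_mul_self, mul_one]⟩,
    length_mul_affReflection_lt (affRoot_isPos_of_isSimple ha) hx⟩

/-- The chain property, by induction on ℓ(y) with a right descent s of y. If x s > x, then x ≤ y s.
Otherwise x s < y s, and an element z just above x s can be multiplied by s or turns out to be x. -/
theorem exists_affBruhatLE_length_eq_add_one [P.IsIrreducible] {x y : ExtAffineWeyl P}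
    (h : affBruhatLE b x y) (hne : x ≠ y) :
    ∃ z, affBruhatLE b x z ∧ affBruhatLE b z y ∧ length b z = length b x + 1 := by
  induction hn : length b y using Nat.strong_induction_on generalizing x y with
  | _ n ih =>
    subst hn
    obtain ⟨a, ha, hya⟩ := exists_simple_descent (b := b) (z := y) (by
      have := h.length_lt hne
      omega)
    have hy := length_mul_simple_of_not_isPos ha hya
    have hylt := bruhatStep_mul_simple ha hya
    set s := affReflection P a with hs
    have hss : ∀ g : ExtAffineWeyl P, g * s * s = g := fun g => by
      rw [mul_assoc, hs, affReflection_mul_self, mul_one]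
    by_cases hxa : (x • a).IsPos b
    · have hx := length_mul_simple_of_isPos ha hxa
      rw [← hs] at hx
      have hxs : BruhatStep b x (x * s) := ⟨⟨a, rfl⟩, by omega⟩
      have hle : affBruhatLE b x (y * s) := by
        rcases h.le_mul_simple ha with h1 | h1
        · exact h1
        · exact hxs.le.trans h1
      by_cases hxy : x = y * s
      · exact ⟨y, h, .refl y, by rw [hxy]; exact hy⟩
      · obtain ⟨z, h1, h2, h3⟩ := ih _ (by omega) hle hxy rfl
        exact ⟨z, h1, h2.trans hylt.le, h3⟩
    · have hx := length_mul_simple_of_not_isPos ha hxa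
      rw [← hs] at hx
      have hxs := bruhatStep_mul_simple ha hxa
      have hle : affBruhatLE b (x * s) (y * s) := by
        rcases h.le_mul_simple ha with h1 | h1
        · exact hxs.le.trans h1
        · exact h1
      have hxy : x * s ≠ y * s := fun h' => hne (mul_right_cancel h')
      obtain ⟨z, h1, h2, h3⟩ := ih _ (by omega) hle hxy rfl
      -- Here ℓ(z) = ℓ(x), since z is one longer than x s. If z s > z, then z s is the element
      -- sought.
      by_cases hza : (z • a).IsPos b
      · have hz := length_mul_simple_of_isPos ha hza
        rw [← hs] at hz
        have hzs : BruhatStep b z (z * s) := ⟨⟨a, rfl⟩, by omega⟩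
        refine ⟨z * s, ?_, ?_, by omega⟩
        · rcases h1.mul_simple ha with h4 | h4
          · rw [hss] at h4
            exact h4.trans hzs.le
          · rwa [hss] at h4
        · rcases h2.mul_simple ha with h4 | h4
          · exact h4.trans hylt.le
          · rwa [hss] at h4
      · have hz := bruhatStep_mul_simple ha hza
        -- When z s < z, lifting x s ≤ z gives x ≤ z, and the lengths agree. So x ≤ y s after all,
        -- and induction applies to this smaller pair.
        have hxz : x = z := by
          refine affBruhatLE.eq_of_length_le (b := b) ?_ (by omega)
          rcases h1.mul_simple ha with h4 | h4
          · rwa [hss] at h4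
          · rw [hss] at h4
            exact h4.trans hz.le
        rw [← hxz] at h2
        by_cases hxy' : x = y * s
        · exact ⟨y, h, .refl y, by rw [hxy']; exact hy⟩
        · obtain ⟨w, h4, h5, h6⟩ := ih _ (by omega) h2 hxy' rfl
          exact ⟨w, h4, h5.trans hylt.le, h6⟩

end Bruhat

/-! ### Comparison with the Coxeter-theoretic definition -/

section Comparison

variable {b : P.Base} [P.IsRootSystem]

omit [Fintype ι] in
theorem mem_simpleReflections_iff {s : ExtAffineWeyl P} :
    s ∈ simpleReflections b ↔ ∃ a : AffRoot ι, a.IsSimple b ∧ s = affReflection P a := by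
  have h1 : ∀ i, affReflection P ⟨negIdx P i, 0⟩ = finIncl P (weylGroup.ofIdx P i) := by
    intro i
    rw [finIncl_ofIdx, ← affReflection_neg ⟨i, 0⟩]
    simp [AffRoot.neg]
  have h2 : ∀ i, affReflection P ⟨i, 1⟩ =
      translation (-corootCoweight P i) * finIncl P (weylGroup.ofIdx P i) := by
    intro i
    simp [affReflection]
  constructor
  · rintro (⟨i, hi, rfl⟩ | ⟨i, hi, rfl⟩)
    · exact ⟨_, Or.inl ⟨i, hi, rfl⟩, (h1 i).symm⟩
    · exact ⟨_, Or.inr ⟨i, hi, rfl⟩, (h2 i).symm⟩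
  · rintro ⟨-, ⟨i, hi, rfl⟩ | ⟨i, hi, rfl⟩, rfl⟩
    · exact Or.inl ⟨i, hi, h1 i⟩
    · exact Or.inr ⟨i, hi, h2 i⟩

omit [Fintype ι] in
theorem exists_affReflection_of_mem_reflections {t : ExtAffineWeyl P}
    (ht : t ∈ reflections (simpleReflections b)) : ∃ a, t = affReflection P a := by
  obtain ⟨g, -, s, hs, rfl⟩ := ht
  obtain ⟨a, -, rfl⟩ := mem_simpleReflections_iff.mp hs
  exact ⟨g • a, (affReflection_smul_root g a).symm⟩

variable [P.IsReduced]

theorem length_mul_simple_le {z : ExtAffineWeyl P} {a : AffRoot ι} (ha : a.IsSimple b) :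
    length b (z * affReflection P a) ≤ length b z + 1 := by
  by_cases h : (z • a).IsPos b
  · exact (length_mul_simple_of_isPos ha h).le
  · have := length_mul_simple_of_not_isPos ha h
    omega

omit [P.IsCrystallographic] [P.IsRootSystem] [P.IsReduced] in
theorem length_one : length b (1 : ExtAffineWeyl P) = 0 := by
  rw [length_eq_ncard, Set.ncard_eq_zero (finite_inversions b _),
    Set.eq_empty_iff_forall_notMem]
  rintro c ⟨h1, h2⟩
  rw [inv_one, one_smul] at h2
  exact h2 h1

/-! ### Words in the simple affine reflections -/

theorem length_list_prod_le {l : List (ExtAffineWeyl P)}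
    (hl : ∀ s ∈ l, s ∈ simpleReflections b) : length b l.prod ≤ l.length := by
  induction l using List.reverseRecOn with
  | nil => simp [length_one]
  | append_singleton l s ih =>
    obtain ⟨a, ha, rfl⟩ := mem_simpleReflections_iff.mp (hl s (by simp))
    rw [List.prod_append, List.prod_singleton, List.length_append, List.length_singleton]
    have := ih fun t ht => hl t (by simp [ht])
    have := length_mul_simple_le (b := b) (z := l.prod) ha
    omega

/-- The exchange condition. Reading the word from the right, a turns negative at some letter s_c;
just before that it equals c, so multiplying by s_a deletes this letter. -/
theorem exists_word_mul_simple {l : List (ExtAffineWeyl P)}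
    (hl : ∀ s ∈ l, s ∈ simpleReflections b) {a : AffRoot ι} (ha : a.IsSimple b)
    (hp : ¬ (l.prod • a).IsPos b) :
    ∃ l' : List (ExtAffineWeyl P), (∀ s ∈ l', s ∈ simpleReflections b) ∧
      l'.prod = l.prod * affReflection P a ∧ l'.length + 1 = l.length := by
  induction l with
  | nil =>
    rw [List.prod_nil, one_smul] at hp
    exact absurd (affRoot_isPos_of_isSimple ha) hp
  | cons s l ih =>
    have hl' : ∀ t ∈ l, t ∈ simpleReflections b := fun t ht => hl t (by simp [ht])
    by_cases h : (l.prod • a).IsPos b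
    · obtain ⟨c, hc, rfl⟩ := mem_simpleReflections_iff.mp (hl s (by simp))
      rw [List.prod_cons, mul_smul] at hp
      have hca := eq_of_not_affReflection_smul_isPos hc h hp
      refine ⟨l, hl', ?_, by simp⟩
      rw [← hca, affReflection_smul_root, List.prod_cons]
      simp only [mul_assoc, inv_mul_cancel_left, affReflection_mul_self, mul_one]
    · obtain ⟨l', h1, h2, h3⟩ := ih hl' h
      refine ⟨s :: l', ?_, ?_, by simp [h3]⟩
      · intro t ht
        rcases List.mem_cons.mp ht with rfl | ht
        · exact hl t (by simp)
        · exact h1 t ht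
      · rw [List.prod_cons, List.prod_cons, h2, mul_assoc]

theorem exists_reduced_word {l : List (ExtAffineWeyl P)}
    (hl : ∀ s ∈ l, s ∈ simpleReflections b) :
    ∃ l' : List (ExtAffineWeyl P), (∀ s ∈ l', s ∈ simpleReflections b) ∧
      l'.prod = l.prod ∧ l'.length = length b l.prod := by
  induction l using List.reverseRecOn with
  | nil => exact ⟨[], by simp, by simp, by simp [length_one]⟩
  | append_singleton l s ih =>
    have hs := hl s (by simp)
    obtain ⟨a, ha, rfl⟩ := mem_simpleReflections_iff.mp hs
    obtain ⟨l', h1, h2, h3⟩ := ih fun t ht => hl t (by simp [ht])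
    rw [List.prod_append, List.prod_singleton]
    by_cases h : (l.prod • a).IsPos b
    · refine ⟨l' ++ [affReflection P a], ?_, by simp [h2], ?_⟩
      · intro t ht
        rcases List.mem_append.mp ht with ht | ht
        · exact h1 t ht
        · rw [List.mem_singleton.mp ht]; exact hs
      · rw [length_mul_simple_of_isPos ha h]
        simp [h3]
    · obtain ⟨l'', h4, h5, h6⟩ := exists_word_mul_simple h1 ha (by rwa [h2])
      refine ⟨l'', h4, by rw [h5, h2], ?_⟩
      have := length_mul_simple_of_not_isPos ha h
      omega

omit [P.IsReduced] in
omit [Fintype ι] in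
theorem exists_word_of_mem_closure {z : ExtAffineWeyl P}
    (hz : z ∈ Subgroup.closure (simpleReflections b)) :
    ∃ l : List (ExtAffineWeyl P), (∀ s ∈ l, s ∈ simpleReflections b) ∧ l.prod = z := by
  induction hz using Subgroup.closure_induction'' with
  | one => exact ⟨[], by simp, rfl⟩
  | mem x hx => exact ⟨[x], by simpa using hx, by simp⟩
  | inv_mem x hx =>
    refine ⟨[x], by simpa using hx, ?_⟩
    obtain ⟨a, -, rfl⟩ := mem_simpleReflections_iff.mp hx
    rw [affReflection_inv, List.prod_singleton]
  | mul x y _ _ hx hy =>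
    obtain ⟨l, h1, rfl⟩ := hx
    obtain ⟨l', h2, rfl⟩ := hy
    refine ⟨l ++ l', ?_, by simp⟩
    intro s hs
    rcases List.mem_append.mp hs with hs | hs
    · exact h1 s hs
    · exact h2 s hs

theorem wordLength_eq_length {z : ExtAffineWeyl P}
    (hz : z ∈ Subgroup.closure (simpleReflections b)) :
    wordLength (simpleReflections b) z = length b z := by
  obtain ⟨l, hl, rfl⟩ := exists_word_of_mem_closure hz
  obtain ⟨l', h1, h2, h3⟩ := exists_reduced_word hl
  refine le_antisymm (Nat.sInf_le ⟨l', h1, h2, h3⟩) (le_csInf ⟨_, l', h1, h2, h3⟩ ?_)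
  rintro n ⟨l'', h4, h5, rfl⟩
  rw [← h5]
  exact length_list_prod_le h4

theorem eq_one_of_length_eq_zero {z : ExtAffineWeyl P}
    (hz : z ∈ Subgroup.closure (simpleReflections b)) (h : length b z = 0) : z = 1 := by
  obtain ⟨l, hl, rfl⟩ := exists_word_of_mem_closure hz
  obtain ⟨l', h1, h2, h3⟩ := exists_reduced_word hl
  rw [h, List.length_eq_zero_iff] at h3
  rw [← h2, h3, List.prod_nil]

omit [P.IsCrystallographic] [P.IsRootSystem] [P.IsReduced] in
theorem length_mul_of_length_eq_zero {τ z : ExtAffineWeyl P} (hτ : length b τ = 0) :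
    length b (τ * z) = length b z := by
  rw [length_eq_ncard, length_eq_ncard]
  refine Set.ncard_congr (fun a _ => τ⁻¹ • a) ?_ ?_ ?_ |>.symm.symm
  · rintro a ⟨h1, h2⟩
    refine ⟨?_, ?_⟩
    · rwa [← smul_isPos_iff_of_length_eq_zero hτ, smul_inv_smul]
    · rwa [mul_inv_rev, mul_smul] at h2
  · intro a c _ _ h
    exact MulAction.injective _ h
  · rintro a ⟨h1, h2⟩
    refine ⟨τ • a, ⟨(smul_isPos_iff_of_length_eq_zero hτ).mpr h1, ?_⟩, inv_smul_smul _ _⟩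
    rwa [mul_inv_rev, mul_smul, inv_smul_smul]

/-! ### Reflections and generators of the affine Weyl group -/

variable [P.IsIrreducible]

/-- Induction on the height of a. Some simple c is made negative by s_a, hence pairs positively with
a; unless a = c, the affine root s_c a is positive of smaller height. This identifies the abstract
reflections with the affine ones. -/
theorem exists_smul_simple_of_isPos {a : AffRoot ι} (ha : a.IsPos b) :
    ∃ g ∈ Subgroup.closure (simpleReflections b), ∃ c : AffRoot ι, c.IsSimple b ∧ a = g • c := by
  induction hn : (affHeight b a).toNat using Nat.strong_induction_on generalizing a with
  | _ n ih =>
    subst hn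
    have hapos := affRoot_isPos_iff.mp ha
    have h0 : length b (affReflection P a) ≠ 0 := by
      have := length_lt_length_mul_affReflection (b := b) (z := 1) ha (by rwa [one_smul])
      rw [one_mul] at this
      omega
    obtain ⟨c, hc, hca⟩ := exists_simple_descent h0
    have hcpos := affRoot_isPos_iff.mp (affRoot_isPos_of_isSimple hc)
    have hn : 0 < P.pairingIn ℤ c.idx a.idx := by
      rw [not_affRoot_isPos_iff, affHeight_affReflection] at hca
      by_contra! h
      nlinarith
    have hn' : 0 < P.pairingIn ℤ a.idx c.idx := (P.zero_lt_pairingIn_iff' ℤ).mp hn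
    by_cases hac : a = c
    · exact ⟨1, one_mem _, c, hc, by rw [one_smul, hac]⟩
    · have h1 := affReflection_smul_isPos hc ha hac
      have h2 := affRoot_isPos_iff.mp h1
      have h3 := affHeight_affReflection (b := b) c a
      obtain ⟨g, hg, d, hd, hgd⟩ := ih (affHeight b (affReflection P c • a)).toNat (by
        have : affHeight b (affReflection P c • a) < affHeight b a := by nlinarith
        omega) h1 rfl
      refine ⟨affReflection P c * g, mul_mem (Subgroup.subset_closure
        (mem_simpleReflections_iff.mpr ⟨c, hc, rfl⟩)) hg, d, hd, ?_⟩
      rw [mul_smul, ← hgd, smul_smul, affReflection_mul_self, one_smul]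

theorem affReflection_mem_reflections (a : AffRoot ι) :
    affReflection P a ∈ reflections (simpleReflections b) := by
  wlog ha : a.IsPos b generalizing a
  · rw [← affReflection_neg]
    exact this _ (affRoot_neg_isPos_iff.mpr ha)
  · obtain ⟨g, hg, c, hc, rfl⟩ := exists_smul_simple_of_isPos ha
    exact ⟨g, hg, _, mem_simpleReflections_iff.mpr ⟨c, hc, rfl⟩, affReflection_smul_root g c⟩

theorem affReflection_mem_closure (a : AffRoot ι) :
    affReflection P a ∈ Subgroup.closure (simpleReflections b) := by
  obtain ⟨g, hg, s, hs, h⟩ := affReflection_mem_reflections (b := b) a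
  rw [h]
  exact mul_mem (mul_mem hg (Subgroup.subset_closure hs)) (inv_mem hg)

theorem finIncl_mem_closure (w : P.weylGroup) :
    finIncl P w ∈ Subgroup.closure (simpleReflections b) := by
  obtain ⟨w, hw⟩ := w
  induction hw using weylGroup.induction with
  | mem i =>
    change finIncl P (weylGroup.ofIdx P i) ∈ _
    rw [finIncl_ofIdx]
    exact affReflection_mem_closure _
  | one =>
    change finIncl P 1 ∈ _
    rw [map_one]
    exact one_mem _
  | mul x y hx hy h h' =>
    change finIncl P (⟨x, hx⟩ * ⟨y, hy⟩) ∈ _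
    rw [map_mul]
    exact mul_mem h h'

omit [Fintype ι] [P.IsCrystallographic] [P.IsRootSystem] [P.IsReduced] [P.IsIrreducible] in
theorem translation_add (χ ψ : coweightLattice P) :
    translation (χ + ψ) = translation χ * translation ψ := by
  simp [translation]

omit [Fintype ι] [P.IsCrystallographic] [P.IsRootSystem] [P.IsReduced] [P.IsIrreducible] in
theorem translation_neg (χ : coweightLattice P) : translation (-χ) = (translation χ)⁻¹ := by
  simp [translation]

omit [Fintype ι] [P.IsCrystallographic] [P.IsRootSystem] [P.IsReduced] [P.IsIrreducible] in
theorem translation_zero : translation (0 : coweightLattice P) = 1 := by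
  simp [translation]

theorem mem_closure_of_mem_affineWeyl {z : ExtAffineWeyl P} (hz : z ∈ affineWeyl P) :
    z ∈ Subgroup.closure (simpleReflections b) := by
  have key : ∀ x ∈ corootLattice P, ∀ h : x ∈ coweightLattice P,
      translation ⟨x, h⟩ ∈ Subgroup.closure (simpleReflections b) := by
    have hle : corootLattice P ≤ coweightLattice P := by
      rw [corootLattice, AddSubgroup.closure_le]
      rintro - ⟨i, rfl⟩
      exact (corootCoweight P i).2
    intro x hx
    induction hx using AddSubgroup.closure_induction with
    | mem x hx =>
      obtain ⟨i, rfl⟩ := hx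
      intro h
      -- Translation by a coroot is the product of the reflections in two parallel hyperplanes.
      have h1 : translation ⟨P.coroot i, h⟩ =
          affReflection P ⟨i, -1⟩ * finIncl P (weylGroup.ofIdx P i) := by
        rw [affReflection, mul_assoc, ← map_mul, ofIdx_mul_self, map_one, mul_one]
        simp [corootCoweight]
      rw [h1]
      exact mul_mem (affReflection_mem_closure _) (finIncl_mem_closure _)
    | zero =>
      intro h
      have : (⟨0, h⟩ : coweightLattice P) = 0 := rfl
      rw [this, translation_zero]
      exact one_mem _
    | add x y hx hy h1 h2 =>
      intro h
      have : (⟨x + y, h⟩ : coweightLattice P) = ⟨x, hle hx⟩ + ⟨y, hle hy⟩ := rfl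
      rw [this, translation_add]
      exact mul_mem (h1 _) (h2 _)
    | neg x hx h1 =>
      intro h
      have : (⟨-x, h⟩ : coweightLattice P) = -⟨x, hle hx⟩ := rfl
      rw [this, translation_neg]
      exact inv_mem (h1 _)
  rw [← SemidirectProduct.inl_left_mul_inr_right z]
  exact mul_mem (key _ hz (Multiplicative.toAdd z.left).2) (finIncl_mem_closure _)

omit [P.IsReduced] [P.IsIrreducible] in
omit [Fintype ι] in
theorem closure_le_affineWeyl :
    Subgroup.closure (simpleReflections b) ≤ affineWeyl P := by
  rw [Subgroup.closure_le]
  intro s hs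
  obtain ⟨a, -, rfl⟩ := mem_simpleReflections_iff.mp hs
  refine mul_mem (?_ : _ ∈ affineWeyl P) (zero_mem (corootLattice P) : _ ∈ affineWeyl P)
  change ((-(a.lvl • corootCoweight P a.idx) : coweightLattice P) : N) ∈ corootLattice P
  refine neg_mem ?_
  have h : P.coroot a.idx ∈ corootLattice P := AddSubgroup.subset_closure ⟨_, rfl⟩
  exact zsmul_mem h a.lvl

theorem exists_length_eq_zero_mul (z : ExtAffineWeyl P) :
    ∃ τ w, length b τ = 0 ∧ w ∈ Subgroup.closure (simpleReflections b) ∧ z = τ * w := by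
  induction hn : length b z generalizing z with
  | zero => exact ⟨z, 1, hn, one_mem _, (mul_one z).symm⟩
  | succ n ih =>
    obtain ⟨a, ha, haz⟩ := exists_simple_descent (b := b) (z := z) (by omega)
    have h1 := length_mul_simple_of_not_isPos ha haz
    obtain ⟨τ, w, h2, h3, h4⟩ := ih (z * affReflection P a) (by omega)
    refine ⟨τ, w * affReflection P a, h2, mul_mem h3 (affReflection_mem_closure a), ?_⟩
    rw [← mul_assoc, ← h4, mul_assoc, affReflection_mul_self, mul_one]

/-- Word length is the inversion count and the reflections are exactly the affine reflections. A
common left factor of length zero permutes the positive affine roots, so it changes no lengths. -/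
theorem bruhatLE_iff {z z' : ExtAffineWeyl P} : bruhatLE b z z' ↔ affBruhatLE b z z' := by
  constructor
  · rintro ⟨τ, w, w', hτ, hw, -, rfl, rfl, h⟩
    have key : w' ∈ Subgroup.closure (simpleReflections b) ∧
        affBruhatLE b (τ * w) (τ * w') := by
      induction h with
      | refl => exact ⟨mem_closure_of_mem_affineWeyl hw, .refl _⟩
      | tail _ hstep ih =>
        obtain ⟨h1, h2⟩ := ih
        obtain ⟨⟨t, ht, rfl⟩, hl⟩ := hstep
        obtain ⟨a, rfl⟩ := exists_affReflection_of_mem_reflections ht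
        have h3 := mul_mem h1 (affReflection_mem_closure (b := b) a)
        rw [wordLength_eq_length h1, wordLength_eq_length h3] at hl
        refine ⟨h3, h2.trans (BruhatStep.le (b := b) ⟨⟨a, (mul_assoc _ _ _).symm⟩, ?_⟩)⟩
        rwa [length_mul_of_length_eq_zero hτ, length_mul_of_length_eq_zero hτ]
    exact key.2
  · intro h
    obtain ⟨τ, w, hτ, hw, rfl⟩ := exists_length_eq_zero_mul (b := b) z
    have key : ∃ w' ∈ Subgroup.closure (simpleReflections b), z' = τ * w' ∧
        coxeterBruhatLE (simpleReflections b) w w' := by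
      induction h with
      | refl => exact ⟨w, hw, rfl, .refl⟩
      | tail _ hstep ih =>
        obtain ⟨w', h1, rfl, h2⟩ := ih
        obtain ⟨⟨a, rfl⟩, hl⟩ := hstep
        have h3 := mul_mem h1 (affReflection_mem_closure (b := b) a)
        refine ⟨_, h3, by rw [mul_assoc],
          h2.tail ⟨⟨_, affReflection_mem_reflections a, rfl⟩, ?_⟩⟩
        rw [wordLength_eq_length h1, wordLength_eq_length h3]
        rwa [mul_assoc, length_mul_of_length_eq_zero hτ, length_mul_of_length_eq_zero hτ] at hl
    obtain ⟨w', h1, rfl, h2⟩ := key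
    exact ⟨τ, w, w', hτ, closure_le_affineWeyl hw, closure_le_affineWeyl h1, rfl, rfl, h2⟩

end Comparison

end ExtAffine

end

noncomputable section

namespace ExtAffine

open RootPairing

variable {ι M N : Type*} [Fintype ι] [AddCommGroup M] [Module ℝ M] [AddCommGroup N] [Module ℝ N]
  {P : RootPairing ι ℝ M N}

/-! ### The length function on the double coset of a dominant translation -/

section LengthFormula

variable {b : P.Base}

omit [Fintype ι] in
theorem toAdd_theta_left (lam : coweightLattice P) (p : P.weylGroup × P.weylGroup) :
    Multiplicative.toAdd (theta lam p).left = weylActCoweight p.2 (-lam) := by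
  rw [theta, ← map_inv]
  simp only [SemidirectProduct.mul_left, finIncl, translation, SemidirectProduct.left_inr,
    SemidirectProduct.left_inl, SemidirectProduct.right_inr, map_one, mul_one, one_mul]
  rfl

omit [Fintype ι] in
theorem theta_right (lam : coweightLattice P) (p : P.weylGroup × P.weylGroup) :
    (theta lam p).right = p.2 * p.1⁻¹ := by
  rw [theta, ← map_inv]
  simp [finIncl, translation]

omit [Fintype ι] in
theorem pair_theta_left (lam : coweightLattice P) (p : P.weylGroup × P.weylGroup) (i : ι) :
    pair (Multiplicative.toAdd (theta lam p).left) i = -pair lam (p.2⁻¹ • i) := by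
  rw [toAdd_theta_left, pair_weylActCoweight, pair_neg]

open Classical in
-- The translation part is -yλ, so reindexing the roots by y expresses every term through ⟨λ, α⟩ and
-- the signs of yα and wα. Under the hypothesis all absolute values open with a uniform sign.
theorem length_theta_eq_sum {lam : coweightLattice P}
    (hlam : ∀ i, b.IsPos i → 0 ≤ pair lam i) {y w : P.weylGroup}
    (h : ∀ i, b.IsPos i → pair lam i = 0 → ¬ b.IsPos (y • i) ∨ b.IsPos (w • i)) :
    (length b (theta lam (w, y)) : ℤ) =
      ∑ i with b.IsPos i, (pair lam i + minLevel b (w • i) - minLevel b (y • i)) := by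
  let g : ι → ℤ := fun i => if b.IsPos (w • i) then |pair lam i| else |1 - pair lam i|
  have h1 : (length b (theta lam (w, y)) : ℤ) = ∑ i with b.IsPos i, g (y⁻¹ • i) := by
    rw [length]
    push_cast
    refine Finset.sum_congr rfl fun i _ => ?_
    rw [pair_theta_left, theta_right, mul_inv_rev, inv_inv, mul_smul]
    simp only [g]
    split_ifs
    · rw [abs_neg]
    · congr 1; ring
  rw [h1, Finset.sum_filter,
    ← Equiv.sum_comp (MulAction.toPerm y) (fun i => if b.IsPos i then g (y⁻¹ • i) else 0)]
  simp only [MulAction.toPerm_apply, inv_smul_smul]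
  rw [sum_eq_sum_isPos b]
  refine Finset.sum_congr (by congr) fun i hi => ?_
  have hi : b.IsPos i := by simpa using hi
  have h2 := hlam i hi
  have h3 := h i hi
  simp only [g, smul_negIdx, pair_negIdx, isPos_negIdx, minLevel]
  by_cases hy : b.IsPos (y • i) <;> by_cases hw : b.IsPos (w • i) <;>
    simp only [hy, hw, if_true, if_false, not_true, not_false_eq_true, abs_neg] at h3 ⊢
  · rw [abs_of_nonneg h2]; ring
  -- The only case that uses the hypothesis: |1 - ⟨λ, α⟩| = ⟨λ, α⟩ - 1 requires ⟨λ, α⟩ ≥ 1.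
  · have h4 : pair lam i ≠ 0 := fun h => by simpa using h3 h
    have h5 : 1 ≤ pair lam i := by omega
    rw [abs_of_nonpos (by linarith)]; ring
  · rw [abs_of_nonneg (by linarith)]; ring
  · rw [abs_of_nonneg h2]; ring

omit [Fintype ι] in
theorem theta_zero (y : P.weylGroup) : theta (0 : coweightLattice P) (1, y) = finIncl P y := by
  simp [theta, translation_zero]

omit [Fintype ι] in
theorem theta_one (lam : coweightLattice P) : theta lam (1, 1) = translation (-lam) := by
  simp [theta]

open Classical in
theorem length_finIncl_eq_sum (w : P.weylGroup) :
    (length b (finIncl P w) : ℤ) = ∑ i with b.IsPos i, (1 - minLevel b (w • i)) := by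
  rw [← theta_zero, length_theta_eq_sum (by simp)]
  · refine Finset.sum_congr rfl fun i hi => ?_
    have hi : b.IsPos i := by simpa using hi
    rw [pair_zero, one_smul, minLevel_of_isPos hi]
    ring
  · intro i hi _
    right
    rwa [one_smul]

theorem length_theta {lam : coweightLattice P}
    (hlam : ∀ i, b.IsPos i → 0 ≤ pair lam i) {y w : P.weylGroup}
    (h : ∀ i, b.IsPos i → pair lam i = 0 → ¬ b.IsPos (y • i) ∨ b.IsPos (w • i)) :
    (length b (theta lam (w, y)) : ℤ) =
      length b (translation (-lam)) + length b (finIncl P y) - length b (finIncl P w) := by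
  classical
  rw [← theta_one, length_theta_eq_sum hlam h, length_finIncl_eq_sum, length_finIncl_eq_sum,
    length_theta_eq_sum hlam, ← Finset.sum_add_distrib, ← Finset.sum_sub_distrib]
  · refine Finset.sum_congr rfl fun i _ => ?_
    ring
  · intro i hi _
    right
    rwa [one_smul]

end LengthFormula

/-! ### Parabolic subgroups of the finite Weyl group -/

section Parabolic

variable {b : P.Base}

omit [Fintype ι] in
-- The base alcove lies in the antidominant chamber, so the finite positive roots correspond to the
-- affine roots -α with constant term 0.
theorem finIncl_smul_isPos_iff {w : P.weylGroup} {i : ι} :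
    (finIncl P w • (⟨negIdx P i, 0⟩ : AffRoot ι)).IsPos b ↔ b.IsPos (w • i) := by
  rw [finIncl_smul, AffRoot.IsPos, smul_negIdx, minLevel]
  simp only [isPos_negIdx]
  split_ifs with h
  · simpa using (isPos_negIdx b).mp h
  · simpa using not_not.mp (mt (isPos_negIdx b).mpr h)

omit [Fintype ι] in
theorem affRoot_negIdx_isPos_iff {i : ι} :
    (⟨negIdx P i, 0⟩ : AffRoot ι).IsPos b ↔ b.IsPos i := by
  simpa using finIncl_smul_isPos_iff (b := b) (w := 1) (i := i)

omit [Fintype ι] in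
theorem isPos_of_pair_pos {lam : coweightLattice P} (hlam : ∀ i, b.IsPos i → 0 ≤ pair lam i)
    {i : ι} (h : 0 < pair lam i) : b.IsPos i := by
  by_contra h'
  have := hlam _ ((isPos_negIdx b).mpr h')
  rw [pair_negIdx] at this
  linarith

omit [Fintype ι] in
theorem IsDominant.pair_nonneg {lam : coweightLattice P} (hlam : IsDominant b lam) {i : ι}
    (hi : b.IsPos i) : 0 ≤ pair lam i := by
  have h := nonneg_of_mem_closure b (f := P.toLinearMap.flip (lam : N)) (fun j hj => by
    have h1 := pair_spec lam j
    rw [RootPairing.root'] at h1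
    rw [LinearMap.flip_apply, h1]
    exact_mod_cast hlam j hj) (root_mem_closure_of_isPos b hi)
  have h1 := pair_spec lam i
  rw [RootPairing.root'] at h1
  rw [LinearMap.flip_apply, h1] at h
  exact_mod_cast h

omit [Fintype ι] in
-- A positive root orthogonal to a dominant λ involves only simple roots in J, because every simple
-- root pairs nonnegatively with λ.
theorem nonneg_of_pair_eq_zero {lam : coweightLattice P} (hlam : IsDominant b lam)
    {f : M →ₗ[ℝ] ℝ} (hf : ∀ j ∈ stabSimple b lam, 0 ≤ f (P.root j)) {i : ι} (hi : b.IsPos i)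
    (h0 : pair lam i = 0) : 0 ≤ f (P.root i) := by
  have key : ∀ x ∈ AddSubmonoid.closure (P.root '' b.support),
      0 ≤ P.toLinearMap x (lam : N) ∧ (P.toLinearMap x (lam : N) = 0 → 0 ≤ f x) := by
    intro x hx
    induction hx using AddSubmonoid.closure_induction with
    | mem x hx =>
      obtain ⟨j, hj, rfl⟩ := hx
      have h1 : P.toLinearMap (P.root j) (lam : N) = (pair lam j : ℝ) := pair_spec lam j
      rw [h1]
      refine ⟨by exact_mod_cast hlam j hj, fun h => hf j ⟨hj, by exact_mod_cast h⟩⟩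
    | zero => simp
    | add x y _ _ hx hy =>
      rw [map_add, map_add, LinearMap.add_apply]
      refine ⟨add_nonneg hx.1 hy.1, fun h => ?_⟩
      have h1 : P.toLinearMap x (lam : N) = 0 := by linarith [hx.1, hy.1]
      have h2 : P.toLinearMap y (lam : N) = 0 := by linarith [hx.1, hy.1]
      exact add_nonneg (hx.2 h1) (hy.2 h2)
  refine (key _ (root_mem_closure_of_isPos b hi)).2 ?_
  have h1 : P.toLinearMap (P.root i) (lam : N) = (pair lam i : ℝ) := pair_spec lam i
  rw [h1, h0, Int.cast_zero]

omit [Fintype ι] in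
theorem isPos_smul_of_forall_stabSimple [P.IsRootSystem] {lam : coweightLattice P}
    (hlam : IsDominant b lam) {w : P.weylGroup}
    (hw : ∀ j ∈ stabSimple b lam, b.IsPos (w • j)) {i : ι} (hi : b.IsPos i)
    (h0 : pair lam i = 0) : b.IsPos (w • i) := by
  have h := nonneg_of_pair_eq_zero hlam
    (f := heightFunctional b ∘ₗ (Equiv.weightHom P w.1 : M →ₗ[ℝ] M)) (fun j hj => ?_) hi h0
  · change 0 ≤ heightFunctional b (w • P.root i) at h
    rw [← root_weylGroup_smul, heightFunctional_root] at h
    rw [Base.isPos_iff']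
    exact_mod_cast h
  · change 0 ≤ heightFunctional b (w • P.root j)
    rw [← root_weylGroup_smul, heightFunctional_root]
    exact_mod_cast ((Base.isPos_iff' b).mp (hw j hj))

omit [Fintype ι] in
theorem not_isPos_smul_of_forall_stabSimple [P.IsRootSystem] {lam : coweightLattice P}
    (hlam : IsDominant b lam) {w : P.weylGroup}
    (hw : ∀ j ∈ stabSimple b lam, ¬ b.IsPos (w • j)) {i : ι} (hi : b.IsPos i)
    (h0 : pair lam i = 0) : ¬ b.IsPos (w • i) := by
  have h := nonneg_of_pair_eq_zero hlam
    (f := -(heightFunctional b ∘ₗ (Equiv.weightHom P w.1 : M →ₗ[ℝ] M))) (fun j hj => ?_) hi h0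
  · change 0 ≤ -heightFunctional b (w • P.root i) at h
    rw [← root_weylGroup_smul, heightFunctional_root] at h
    rw [Base.isPos_iff, not_lt]
    have : (b.height (w • i) : ℝ) ≤ 0 := by linarith
    exact_mod_cast this
  · change 0 ≤ -heightFunctional b (w • P.root j)
    rw [← root_weylGroup_smul, heightFunctional_root]
    have h1 := hw j hj
    rw [Base.isPos_iff, not_lt] at h1
    have : (b.height (w • j) : ℝ) ≤ 0 := by exact_mod_cast h1
    linarith

variable [P.IsCrystallographic] [P.IsRootSystem]

omit [Fintype ι] in
theorem affReflection_negIdx_zero (i : ι) :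
    affReflection P ⟨negIdx P i, 0⟩ = finIncl P (weylGroup.ofIdx P i) := by
  rw [finIncl_ofIdx, ← affReflection_neg ⟨i, 0⟩]
  simp [AffRoot.neg]

theorem length_lt_mul_ofIdx_iff {w : P.weylGroup} {i : ι} (hi : b.IsPos i) :
    length b (finIncl P w) < length b (finIncl P (w * weylGroup.ofIdx P i)) ↔
      b.IsPos (w • i) := by
  rw [map_mul, ← affReflection_negIdx_zero,
    length_lt_mul_affReflection_iff (affRoot_negIdx_isPos_iff.mpr hi), finIncl_smul_isPos_iff]

theorem length_mul_ofIdx_lt_iff {w : P.weylGroup} {i : ι} (hi : b.IsPos i) :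
    length b (finIncl P (w * weylGroup.ofIdx P i)) < length b (finIncl P w) ↔
      ¬ b.IsPos (w • i) := by
  rw [← length_lt_mul_ofIdx_iff hi, not_lt]
  refine ⟨le_of_lt, fun h => lt_of_le_of_ne h fun h' => ?_⟩
  have h1 := length_lt_mul_ofIdx_iff (b := b) (w := w) hi
  have h2 := length_lt_mul_ofIdx_iff (b := b) (w := w * weylGroup.ofIdx P i) hi
  rw [mul_assoc, ofIdx_mul_self, mul_one, h', mul_smul, ofIdx_smul_index] at h2
  change _ ↔ b.IsPos (w • negIdx P i) at h2
  rw [smul_negIdx, isPos_negIdx] at h2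
  rw [h'] at h1
  tauto

theorem isPos_smul_of_mem_minReps {lam : coweightLattice P} (hlam : IsDominant b lam)
    {x : P.weylGroup} (hx : x ∈ minReps b (stabSimple b lam)) {i : ι} (hi : b.IsPos i)
    (h0 : pair lam i = 0) : b.IsPos (x • i) := by
  refine isPos_smul_of_forall_stabSimple hlam (fun j hj => ?_) hi h0
  by_contra h
  have h1 := hx (weylGroup.ofIdx P j) (Subgroup.subset_closure ⟨j, hj, rfl⟩)
  have h2 := (length_mul_ofIdx_lt_iff (Base.isPos_of_mem_support hj.1)).mpr h
  omega

omit [Fintype ι] [P.IsCrystallographic] [P.IsRootSystem] in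
theorem exists_minReps_mul [Fintype ι] (J : Set ι) (w : P.weylGroup) :
    ∃ x ∈ minReps b J, ∃ u ∈ parabolic P J, w = x * u := by
  let f : P.weylGroup → ℕ := fun u => length b (finIncl P (w * u))
  have hne : (parabolic P J : Set P.weylGroup).Nonempty := ⟨1, one_mem _⟩
  obtain ⟨u, hu, hmin⟩ : ∃ u ∈ parabolic P J, ∀ v ∈ parabolic P J, f u ≤ f v := by
    obtain ⟨n, ⟨u, hu, rfl⟩, hn⟩ := WellFounded.has_min wellFounded_lt
      (f '' (parabolic P J : Set P.weylGroup)) (hne.image f)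
    exact ⟨u, hu, fun v hv => not_lt.mp (hn _ ⟨v, hv, rfl⟩)⟩
  refine ⟨w * u, fun v hv => ?_, u⁻¹, inv_mem hu, by group⟩
  have := hmin (u * v) (mul_mem hu hv)
  rwa [mul_assoc]

theorem exists_mul_parabolic_forall_not_isPos (lam : coweightLattice P) (w : P.weylGroup) :
    ∃ u ∈ parabolic P (stabSimple b lam), ∀ j ∈ stabSimple b lam, ¬ b.IsPos ((w * u) • j) := by
  -- Minimizing this colength maximizes the length in the coset w W_J; `length_finIncl_le` keeps the
  -- natural subtraction from truncating.
  let f : P.weylGroup → ℕ := fun u => Fintype.card ι - length b (finIncl P (w * u))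
  have hne : (parabolic P (stabSimple b lam) : Set P.weylGroup).Nonempty := ⟨1, one_mem _⟩
  obtain ⟨n, ⟨u, hu, rfl⟩, hn⟩ := WellFounded.has_min wellFounded_lt
    (f '' (parabolic P (stabSimple b lam) : Set P.weylGroup)) (hne.image f)
  refine ⟨u, hu, fun j hj h => ?_⟩
  have h1 := (length_lt_mul_ofIdx_iff (Base.isPos_of_mem_support hj.1)).mpr h
  have h2 := length_finIncl_le b (w * u * weylGroup.ofIdx P j)
  refine hn _ ⟨u * weylGroup.ofIdx P j, mul_mem hu (Subgroup.subset_closure ⟨j, hj, rfl⟩), rfl⟩ ?_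
  simp only [f, ← mul_assoc]
  omega

omit [Fintype ι] [P.IsRootSystem] in
theorem pair_smul_of_mem_parabolic {lam : coweightLattice P} {u : P.weylGroup}
    (hu : u ∈ parabolic P (stabSimple b lam)) (i : ι) : pair lam (u • i) = pair lam i := by
  induction hu using Subgroup.closure_induction generalizing i with
  | mem u hu =>
    obtain ⟨j, hj, rfl⟩ := hu
    rw [ofIdx_smul_index, pair_of_root_eq_sub_zsmul (root_reflectionPerm_eq j i), hj.2, mul_zero,
      sub_zero]
  | one => rw [one_smul]
  | mul u v _ _ hu hv => rw [mul_smul, hu, hv]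
  | inv u _ hu => rw [← hu, smul_inv_smul]

variable [P.IsReduced] [P.IsIrreducible]

theorem exists_support_not_isPos_smul {w : P.weylGroup} (hw : w ≠ 1) :
    ∃ i ∈ b.support, ¬ b.IsPos (w • i) := by
  have h0 : length b (finIncl P w) ≠ 0 := by
    intro h
    have := eq_one_of_length_eq_zero (finIncl_mem_closure w) h
    exact hw (SemidirectProduct.inr_injective (this.trans (map_one (finIncl P)).symm))
  obtain ⟨a, ⟨i, hi, rfl⟩ | ⟨i, hi, rfl⟩, ha⟩ := exists_simple_descent h0
  · exact ⟨i, hi, mt finIncl_smul_isPos_iff.mpr ha⟩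
  -- The descent cannot be at s_0: a finite Weyl group element keeps the constant term 1, so the
  -- image stays positive.
  · exfalso
    apply ha
    rw [finIncl_smul, AffRoot.IsPos, minLevel]
    split_ifs <;> simp

/-- The stabilizer of λ is W_J. At a simple descent α_i of v, ⟨λ, α_i⟩ > 0 would give ⟨λ, vα_i⟩ > 0
and hence vα_i > 0; so i ∈ J, and v s_i is shorter. -/
theorem mem_parabolic_of_pair_smul {lam : coweightLattice P} (hlam : IsDominant b lam)
    {v : P.weylGroup} (hv : ∀ i, pair lam (v • i) = pair lam i) :
    v ∈ parabolic P (stabSimple b lam) := by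
  induction hn : length b (finIncl P v) using Nat.strong_induction_on generalizing v with
  | _ n ih =>
    subst hn
    by_cases hv1 : v = 1
    · rw [hv1]; exact one_mem _
    · obtain ⟨i, hi, hvi⟩ := exists_support_not_isPos_smul (b := b) hv1
      have h0 : pair lam i = 0 := by
        refine le_antisymm (not_lt.mp fun h => ?_) (hlam i hi)
        exact hvi (isPos_of_pair_pos (fun _ => hlam.pair_nonneg) (by rwa [hv]))
      have hmem : weylGroup.ofIdx P i ∈ parabolic P (stabSimple b lam) :=
        Subgroup.subset_closure ⟨i, ⟨hi, h0⟩, rfl⟩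
      have h1 := (length_mul_ofIdx_lt_iff (Base.isPos_of_mem_support hi)).mpr hvi
      have h2 := ih _ h1 (v := v * weylGroup.ofIdx P i) (fun j => by
        rw [mul_smul, hv, pair_smul_of_mem_parabolic hmem]) rfl
      have h3 := mul_mem h2 hmem
      rwa [mul_assoc, ofIdx_mul_self, mul_one] at h3

theorem exists_stabSimple_not_isPos_smul {lam : coweightLattice P} (hlam : IsDominant b lam)
    {u : P.weylGroup} (hu : u ∈ parabolic P (stabSimple b lam)) (hu1 : u ≠ 1) :
    ∃ i ∈ stabSimple b lam, ¬ b.IsPos (u • i) := by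
  obtain ⟨i, hi, hui⟩ := exists_support_not_isPos_smul (b := b) hu1
  refine ⟨i, ⟨hi, le_antisymm (not_lt.mp fun h => hui ?_) (hlam i hi)⟩, hui⟩
  exact isPos_of_pair_pos (fun _ => hlam.pair_nonneg) (by rwa [pair_smul_of_mem_parabolic hu])

theorem eq_one_of_mul_mem_minReps {lam : coweightLattice P} (hlam : IsDominant b lam)
    {x u : P.weylGroup} (hx : x ∈ minReps b (stabSimple b lam))
    (hu : u ∈ parabolic P (stabSimple b lam)) (hxu : x * u ∈ minReps b (stabSimple b lam)) :
    u = 1 := by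
  by_contra hu1
  obtain ⟨i, hi, hui⟩ := exists_stabSimple_not_isPos_smul hlam hu hu1
  have h1 := isPos_smul_of_mem_minReps hlam hxu (Base.isPos_of_mem_support hi.1) hi.2
  have h2 := isPos_smul_of_mem_minReps hlam hx ((isPos_negIdx b).mpr hui) (by
    rw [pair_negIdx, pair_smul_of_mem_parabolic hu, hi.2, neg_zero])
  rw [smul_negIdx, isPos_negIdx, ← mul_smul] at h2
  exact h2 h1

end Parabolic

/-! ### Lifting along parabolic subgroups -/

section Lifting

variable {b : P.Base} [P.IsCrystallographic] [P.IsRootSystem] [P.IsReduced] [P.IsIrreducible]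

/-- The Bruhat order of the finite Weyl group in terms of reflections. -/
def finLE (b : P.Base) (x y : P.weylGroup) : Prop := affBruhatLE b (finIncl P x) (finIncl P y)

theorem finBruhatLE_iff {x y : P.weylGroup} : finBruhatLE b x y ↔ finLE b x y := bruhatLE_iff

omit [P.IsReduced] [P.IsIrreducible] [P.IsRootSystem] in
theorem finLE.refl (x : P.weylGroup) : finLE b x x := affBruhatLE.refl _

omit [P.IsReduced] [P.IsIrreducible] [P.IsRootSystem] in
theorem finLE.trans {x y z : P.weylGroup} (h : finLE b x y) (h' : finLE b y z) : finLE b x z :=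
  affBruhatLE.trans h h'

omit [P.IsReduced] [P.IsIrreducible] in
theorem bruhatStep_mul_ofIdx {w : P.weylGroup} {i : ι}
    (h : length b (finIncl P w) < length b (finIncl P (w * weylGroup.ofIdx P i))) :
    BruhatStep b (finIncl P w) (finIncl P (w * weylGroup.ofIdx P i)) :=
  ⟨⟨⟨i, 0⟩, by rw [map_mul, finIncl_ofIdx]⟩, h⟩

omit [P.IsReduced] [P.IsIrreducible] in
theorem bruhatStep_of_mul_ofIdx {w : P.weylGroup} {i : ι}
    (h : length b (finIncl P (w * weylGroup.ofIdx P i)) < length b (finIncl P w)) :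
    BruhatStep b (finIncl P (w * weylGroup.ofIdx P i)) (finIncl P w) :=
  ⟨⟨⟨i, 0⟩, by rw [← finIncl_ofIdx, ← map_mul, mul_assoc, ofIdx_mul_self, mul_one]⟩, h⟩

omit [P.IsIrreducible] in
theorem finLE.mul_simple {x y : P.weylGroup} (h : finLE b x y) {i : ι} (hi : i ∈ b.support) :
    finLE b (x * weylGroup.ofIdx P i) y ∨
      finLE b (x * weylGroup.ofIdx P i) (y * weylGroup.ofIdx P i) := by
  simp only [finLE, map_mul, ← affReflection_negIdx_zero]
  exact affBruhatLE.mul_simple h (Or.inl ⟨i, hi, rfl⟩)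

omit [P.IsIrreducible] in
theorem finLE.le_mul_simple {x y : P.weylGroup} (h : finLE b x y) {i : ι} (hi : i ∈ b.support) :
    finLE b x (y * weylGroup.ofIdx P i) ∨
      finLE b (x * weylGroup.ofIdx P i) (y * weylGroup.ofIdx P i) := by
  simp only [finLE, map_mul, ← affReflection_negIdx_zero]
  exact affBruhatLE.le_mul_simple h (Or.inl ⟨i, hi, rfl⟩)

/-- An induction principle for parabolic subgroups along right descents. -/
theorem parabolic_induction {lam : coweightLattice P} (hlam : IsDominant b lam)
    {p : P.weylGroup → Prop} (one : p 1)
    (mul : ∀ u ∈ parabolic P (stabSimple b lam), ∀ i ∈ stabSimple b lam, b.IsPos (u • i) → p u →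
      p (u * weylGroup.ofIdx P i))
    {u : P.weylGroup} (hu : u ∈ parabolic P (stabSimple b lam)) : p u := by
  induction hn : length b (finIncl P u) using Nat.strong_induction_on generalizing u with
  | _ n ih =>
    subst hn
    by_cases hu1 : u = 1
    · rwa [hu1]
    · obtain ⟨i, hi, hui⟩ := exists_stabSimple_not_isPos_smul hlam hu hu1
      have hmem : weylGroup.ofIdx P i ∈ parabolic P (stabSimple b lam) :=
        Subgroup.subset_closure ⟨i, hi, rfl⟩
      have h1 := (length_mul_ofIdx_lt_iff (Base.isPos_of_mem_support hi.1)).mpr hui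
      have h2 := mul _ (mul_mem hu hmem) i hi (by
        rw [mul_smul, ofIdx_smul_index]
        change b.IsPos (u • negIdx P i)
        rw [smul_negIdx, isPos_negIdx]
        exact hui) (ih _ h1 (mul_mem hu hmem) rfl)
      rwa [mul_assoc, ofIdx_mul_self, mul_one] at h2

omit [P.IsReduced] [P.IsIrreducible] in
theorem bruhatStep_minReps_mul {lam : coweightLattice P} (hlam : IsDominant b lam)
    {x u : P.weylGroup} (hx : x ∈ minReps b (stabSimple b lam))
    (hu : u ∈ parabolic P (stabSimple b lam)) {i : ι} (hi : i ∈ stabSimple b lam)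
    (hui : b.IsPos (u • i)) : finLE b (x * u) (x * (u * weylGroup.ofIdx P i)) := by
  rw [← mul_assoc]
  refine (bruhatStep_mul_ofIdx
    ((length_lt_mul_ofIdx_iff (Base.isPos_of_mem_support hi.1)).mpr ?_)).le
  rw [mul_smul]
  exact isPos_smul_of_mem_minReps hlam hx hui (by rw [pair_smul_of_mem_parabolic hu, hi.2])

/-- Builds v along a reduced word of u by lifting. The condition x v ≤ x u records v ≤ u in a form
already translated by a minimal representative x, which is how it gets used. -/
theorem finLE.exists_mul_parabolic {lam : coweightLattice P} (hlam : IsDominant b lam)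
    {x y z u : P.weylGroup} (h : finLE b y z) (hx : x ∈ minReps b (stabSimple b lam))
    (hu : u ∈ parabolic P (stabSimple b lam)) :
    ∃ v ∈ parabolic P (stabSimple b lam), finLE b (y * u) (z * v) ∧ finLE b (x * v) (x * u) := by
  refine parabolic_induction (p := fun u => ∃ v ∈ parabolic P (stabSimple b lam),
    finLE b (y * u) (z * v) ∧ finLE b (x * v) (x * u)) hlam ?_ ?_ hu
  · exact ⟨1, one_mem _, by simpa using h, .refl _⟩
  · rintro u hu i hi hui ⟨v, hv, h1, h2⟩
    have hstep := bruhatStep_minReps_mul hlam hx hu hi hui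
    rcases h1.mul_simple hi.1 with h3 | h3
    · exact ⟨v, hv, by rwa [← mul_assoc], h2.trans hstep⟩
    · refine ⟨v * weylGroup.ofIdx P i, mul_mem hv (Subgroup.subset_closure ⟨i, hi, rfl⟩),
        by rwa [← mul_assoc, ← mul_assoc], ?_⟩
      rcases h2.mul_simple hi.1 with h4 | h4
      · rw [← mul_assoc]; exact h4.trans hstep
      · rwa [← mul_assoc, ← mul_assoc]

/-- Moves the letters of u, last one first, from the right of z to the right of y, or drops them;
v⁻¹ collects those that move. This gives (iii) ⇒ (ii). -/
theorem finLE.exists_mul_parabolic_le {lam : coweightLattice P} (hlam : IsDominant b lam)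
    {x y z u : P.weylGroup} (h : finLE b y (z * u)) (hx : x ∈ minReps b (stabSimple b lam))
    (hu : u ∈ parabolic P (stabSimple b lam)) :
    ∃ v ∈ parabolic P (stabSimple b lam), finLE b (y * v) z ∧ finLE b (x * v⁻¹) (x * u) := by
  refine parabolic_induction (p := fun u => ∀ y, finLE b y (z * u) →
    ∃ v ∈ parabolic P (stabSimple b lam), finLE b (y * v) z ∧ finLE b (x * v⁻¹) (x * u))
    hlam ?_ ?_ hu y h
  · exact fun y h => ⟨1, one_mem _, by simpa using h, by simpa using finLE.refl x⟩
  · intro u hu i hi hui ih y h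
    have hstep := bruhatStep_minReps_mul hlam hx hu hi hui
    rcases h.le_mul_simple hi.1 with h1 | h1
    all_goals rw [mul_assoc, mul_assoc, ofIdx_mul_self, mul_one] at h1
    · obtain ⟨v, hv, h2, h3⟩ := ih y h1
      exact ⟨v, hv, h2, h3.trans hstep⟩
    · obtain ⟨v, hv, h2, h3⟩ := ih _ h1
      refine ⟨weylGroup.ofIdx P i * v, mul_mem (Subgroup.subset_closure ⟨i, hi, rfl⟩) hv,
        by rwa [← mul_assoc], ?_⟩
      rw [mul_inv_rev, ofIdx_inv, ← mul_assoc]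
      rcases h3.mul_simple hi.1 with h4 | h4
      · exact h4.trans hstep
      · rwa [← mul_assoc]

theorem finLE.mul_parabolic {lam : coweightLattice P} (hlam : IsDominant b lam)
    {x y u : P.weylGroup} (h : finLE b y x) (hx : x ∈ minReps b (stabSimple b lam))
    (hu : u ∈ parabolic P (stabSimple b lam)) : finLE b (y * u) (x * u) := by
  obtain ⟨v, -, h1, h2⟩ := h.exists_mul_parabolic hlam hx hu
  exact h1.trans h2

omit [P.IsReduced] [P.IsIrreducible] in
-- A Bruhat chain ending in W consists of finite elements and finite reflections, so relations on W
-- can be proved one finite reflection at a time.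
theorem finLE.induction {p : P.weylGroup → P.weylGroup → Prop} (refl : ∀ w, p w w)
    (trans : ∀ u v w, p u v → p v w → p u w)
    (step : ∀ w i, length b (finIncl P w) < length b (finIncl P (w * weylGroup.ofIdx P i)) →
      p w (w * weylGroup.ofIdx P i)) {v w : P.weylGroup} (h : finLE b v w) : p v w := by
  have key : ∀ z, affBruhatLE b z (finIncl P w) → ∃ u, z = finIncl P u ∧ p u w := by
    intro z hz
    induction hz using Relation.ReflTransGen.head_induction_on with
    | refl => exact ⟨w, rfl, refl w⟩
    | head hstep _ ih =>
      rename_i z _ _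
      obtain ⟨u, rfl, hu⟩ := ih
      obtain ⟨a, ha, hza, he⟩ := hstep.exists_isPos
      have h1 : z = finIncl P u * affReflection P a := by
        rw [he, mul_assoc, affReflection_mul_self, mul_one]
      rw [h1, mul_smul, affReflection_smul_self, smul_affRoot_neg, affRoot_neg_isPos_iff,
        finIncl_smul] at hza
      obtain ⟨i, k⟩ := a
      -- Finite elements preserve constant terms. A positive affine root with constant term at least
      -- 1 would stay positive, but this one becomes negative.
      have hk : k = 0 := by
        simp only [AffRoot.IsPos, minLevel] at ha hza
        split_ifs at ha hza <;> omega
      subst hk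
      rw [← finIncl_ofIdx, ← map_mul] at h1
      subst h1
      refine ⟨_, rfl, trans _ _ _ ?_ hu⟩
      have h2 := step (u * weylGroup.ofIdx P i) i (by
        rw [mul_assoc, ofIdx_mul_self, mul_one]; exact hstep.2)
      rwa [mul_assoc, ofIdx_mul_self, mul_one] at h2
  obtain ⟨u, hu, h1⟩ := key _ h
  rwa [← SemidirectProduct.inr_injective hu] at h1

end Lifting

end ExtAffine

end

noncomputable section

namespace ExtAffine

open RootPairing

variable {ι M N : Type*} [Fintype ι] [AddCommGroup M] [Module ℝ M] [AddCommGroup N] [Module ℝ N]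
  {P : RootPairing ι ℝ M N}

/-! ### The norm of the translation part along the Bruhat order -/

section Norm

/-- The Weyl group invariant norm of a coweight. -/
def normSq (χ : coweightLattice P) : ℤ := ∑ i, pair χ i ^ 2

theorem normSq_weylActCoweight (w : P.weylGroup) (χ : coweightLattice P) :
    normSq (weylActCoweight w χ) = normSq χ := by
  simp only [normSq, pair_weylActCoweight]
  exact Equiv.sum_comp (MulAction.toPerm w⁻¹) fun i => pair χ i ^ 2

theorem normSq_neg (χ : coweightLattice P) : normSq (-χ) = normSq χ := by
  simp [normSq]

theorem normSq_theta_left (lam : coweightLattice P) (p : P.weylGroup × P.weylGroup) :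
    normSq (Multiplicative.toAdd (theta lam p).left) = normSq lam := by
  rw [toAdd_theta_left, normSq_weylActCoweight, normSq_neg]

variable [P.IsCrystallographic]

/-- In terms of the invariant form (χ, ψ) = ∑ ⟨χ, α⟩⟨ψ, α⟩ this is 2(χ, α_i^∨) = ⟨χ, α_i⟩ |α_i^∨|².
It comes from reindexing the sum by the reflection in α_i. -/
theorem two_mul_sum_pair_mul_pairingIn (χ : coweightLattice P) (i : ι) :
    2 * ∑ j, pair χ j * P.pairingIn ℤ j i = pair χ i * ∑ j, P.pairingIn ℤ j i ^ 2 := by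
  have h : ∑ j, pair χ j * P.pairingIn ℤ j i =
      ∑ j, (pair χ j - P.pairingIn ℤ j i * pair χ i) * -P.pairingIn ℤ j i := by
    rw [← Equiv.sum_comp (P.reflectionPerm i) fun j => pair χ j * P.pairingIn ℤ j i]
    refine Finset.sum_congr rfl fun j _ => ?_
    rw [pair_of_root_eq_sub_zsmul (root_reflectionPerm_eq i j), ← pairingIn_reflectionPerm,
      pairingIn_reflectionPerm_self_right]
  have h2 : ∑ j, (pair χ j - P.pairingIn ℤ j i * pair χ i) * -P.pairingIn ℤ j i =
      -(∑ j, pair χ j * P.pairingIn ℤ j i) + pair χ i * ∑ j, P.pairingIn ℤ j i ^ 2 := by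
    rw [Finset.mul_sum, ← Finset.sum_neg_distrib, ← Finset.sum_add_distrib]
    exact Finset.sum_congr rfl fun j _ => by ring
  linarith

theorem normSq_of_pair_eq_sub {χ ψ : coweightLattice P} {i : ι} {k n : ℤ}
    (h : ∀ j, pair ψ j = pair χ j - P.pairingIn ℤ j i * n) (hn : n = k + pair χ i) :
    normSq ψ = normSq χ + k * n * ∑ j, P.pairingIn ℤ j i ^ 2 := by
  have h1 := two_mul_sum_pair_mul_pairingIn χ i
  have h2 : normSq ψ = normSq χ - n * (2 * ∑ j, pair χ j * P.pairingIn ℤ j i) +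
      n ^ 2 * ∑ j, P.pairingIn ℤ j i ^ 2 := by
    rw [normSq, normSq, Finset.mul_sum, Finset.mul_sum, Finset.mul_sum, ← Finset.sum_sub_distrib,
      ← Finset.sum_add_distrib]
    refine Finset.sum_congr rfl fun j _ => ?_
    rw [h j]
    ring
  rw [h2, h1, hn]
  ring

theorem sum_pairingIn_sq_pos (i : ι) : 0 < ∑ j, P.pairingIn ℤ j i ^ 2 :=
  Finset.sum_pos' (fun j _ => sq_nonneg _) ⟨i, Finset.mem_univ i, by rw [pairingIn_same]; norm_num⟩

variable [P.IsRootSystem] {b : P.Base}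

/-- For a step c → c s_a with a and c a positive, n and k are the constant terms of a and c a. Right
multiplication by s_a equals left multiplication by s_{c a}, so the step is a finite reflection on
the right if n = 0 and on the left if k = 0. -/
theorem BruhatStep.exists_left_data {c d : ExtAffineWeyl P} (h : BruhatStep b c d) :
    ∃ (i : ι) (k n : ℤ), 0 ≤ k ∧ 0 ≤ n ∧ n = k + pair (Multiplicative.toAdd c.left) i ∧
      (∀ j, pair (Multiplicative.toAdd d.left) j =
        pair (Multiplicative.toAdd c.left) j - P.pairingIn ℤ j i * n) ∧
      (k = 0 → d = finIncl P (weylGroup.ofIdx P i) * c) ∧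
      (n = 0 → ∃ j, d = c * finIncl P (weylGroup.ofIdx P j)) := by
  obtain ⟨a, ha, hca, rfl⟩ := h.exists_isPos
  have hle : ∀ i, 0 ≤ minLevel b i := fun i => by rw [minLevel]; split_ifs <;> simp
  have hd : c * affReflection P a = affReflection P (c • a) * c := by
    rw [affReflection_smul_root, inv_mul_cancel_right]
  have hl : (c • a).lvl = a.lvl - pair (Multiplicative.toAdd c.left) (c • a).idx := rfl
  refine ⟨(c • a).idx, (c • a).lvl, a.lvl, (hle _).trans hca, (hle _).trans ha, by rw [hl]; ring,
    fun j => ?_, fun hk => ?_, fun hn => ⟨a.idx, ?_⟩⟩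
  · have h1 : Multiplicative.toAdd (affReflection P (c • a) * c).left =
        -((c • a).lvl • corootCoweight P (c • a).idx) +
          weylActCoweight (weylGroup.ofIdx P (c • a).idx) (Multiplicative.toAdd c.left) := by
      simp only [affReflection, SemidirectProduct.mul_left, finIncl, translation,
        SemidirectProduct.left_inr, SemidirectProduct.left_inl, SemidirectProduct.right_inr,
        SemidirectProduct.mul_right, SemidirectProduct.right_inl, map_one, mul_one, one_mul]
      rfl
    rw [hd, h1, pair_add, pair_neg, pair_zsmul, pair_corootCoweight, pair_weylActCoweight, ofIdx_inv,
      ofIdx_smul_index, pair_of_root_eq_sub_zsmul (root_reflectionPerm_eq _ _)]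
    have h2 : a.lvl = (c • a).lvl + pair (Multiplicative.toAdd c.left) (c • a).idx := by
      rw [hl]; ring
    rw [h2]
    ring
  · rw [hd, finIncl_ofIdx]
    congr 2
    exact AffRoot.ext rfl hk
  · rw [finIncl_ofIdx]
    congr 2
    exact AffRoot.ext rfl hn

theorem BruhatStep.normSq_le {c d : ExtAffineWeyl P} (h : BruhatStep b c d) :
    normSq (Multiplicative.toAdd c.left) ≤ normSq (Multiplicative.toAdd d.left) := by
  obtain ⟨i, k, n, hk, hn, hkn, hd, -, -⟩ := h.exists_left_data
  rw [normSq_of_pair_eq_sub hd hkn]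
  have := sum_pairingIn_sq_pos (P := P) i
  have : 0 ≤ k * n * ∑ j, P.pairingIn ℤ j i ^ 2 := by positivity
  linarith

theorem BruhatStep.eq_mul_ofIdx_of_normSq_le {c d : ExtAffineWeyl P} (h : BruhatStep b c d)
    (hle : normSq (Multiplicative.toAdd d.left) ≤ normSq (Multiplicative.toAdd c.left)) :
    (∃ i, d = finIncl P (weylGroup.ofIdx P i) * c) ∨
      ∃ i, d = c * finIncl P (weylGroup.ofIdx P i) := by
  obtain ⟨i, k, n, hk, hn, hkn, hd, h1, h2⟩ := h.exists_left_data
  rw [normSq_of_pair_eq_sub hd hkn] at hle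
  have h3 := sum_pairingIn_sq_pos (P := P) i
  have h4 : k * n = 0 := by
    have : 0 ≤ k * n := by positivity
    nlinarith
  rcases mul_eq_zero.mp h4 with h5 | h5
  · exact Or.inl ⟨i, h1 h5⟩
  · exact Or.inr (h2 h5)

theorem affBruhatLE.normSq_le {c d : ExtAffineWeyl P} (h : affBruhatLE b c d) :
    normSq (Multiplicative.toAdd c.left) ≤ normSq (Multiplicative.toAdd d.left) := by
  induction h with
  | refl => rfl
  | tail _ hstep ih => exact ih.trans hstep.normSq_le

end Norm

/-! ### The double coset of a dominant translation -/

section DoubleCoset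

omit [Fintype ι] in
theorem finIncl_mul_theta (lam : coweightLattice P) (v x y : P.weylGroup) :
    finIncl P v * theta lam (x, y) = theta lam (x, v * y) := by
  simp [theta, mul_assoc]

omit [Fintype ι] in
theorem theta_mul_finIncl (lam : coweightLattice P) (v x y : P.weylGroup) :
    theta lam (x, y) * finIncl P v = theta lam (v⁻¹ * x, y) := by
  simp [theta, mul_assoc]

omit [Fintype ι] in
theorem theta_mul_ofIdx (lam : coweightLattice P) (x y : P.weylGroup) (i : ι) :
    theta lam (x, y) * finIncl P (weylGroup.ofIdx P i) =
      theta lam (weylGroup.ofIdx P i * x, y) := by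
  rw [theta_mul_finIncl, ofIdx_inv]

omit [Fintype ι] in
theorem mem_transDoubleCoset_iff {lam : coweightLattice P} {z : ExtAffineWeyl P} :
    z ∈ transDoubleCoset lam ↔ ∃ x y, z = theta lam (x, y) := by
  rw [transDoubleCoset, DoubleCoset.mem_doubleCoset]
  constructor
  · rintro ⟨-, ⟨y, rfl⟩, -, ⟨x, rfl⟩, rfl⟩
    exact ⟨x⁻¹, y, by simp [theta]⟩
  · rintro ⟨x, y, rfl⟩
    exact ⟨_, ⟨y, rfl⟩, _, ⟨x⁻¹, rfl⟩, by simp [theta]⟩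

omit [Fintype ι] in
theorem finIncl_mul_mem_transDoubleCoset {lam : coweightLattice P} {z : ExtAffineWeyl P}
    (v : P.weylGroup) (hz : z ∈ transDoubleCoset lam) : finIncl P v * z ∈ transDoubleCoset lam := by
  obtain ⟨x, y, rfl⟩ := mem_transDoubleCoset_iff.mp hz
  exact mem_transDoubleCoset_iff.mpr ⟨_, _, finIncl_mul_theta lam v x y⟩

omit [Fintype ι] in
theorem mul_finIncl_mem_transDoubleCoset {lam : coweightLattice P} {z : ExtAffineWeyl P}
    (v : P.weylGroup) (hz : z ∈ transDoubleCoset lam) : z * finIncl P v ∈ transDoubleCoset lam := by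
  obtain ⟨x, y, rfl⟩ := mem_transDoubleCoset_iff.mp hz
  exact mem_transDoubleCoset_iff.mpr ⟨_, _, theta_mul_finIncl lam v x y⟩

theorem normSq_of_mem_transDoubleCoset {lam : coweightLattice P} {z : ExtAffineWeyl P}
    (hz : z ∈ transDoubleCoset lam) : normSq (Multiplicative.toAdd z.left) = normSq lam := by
  obtain ⟨x, y, rfl⟩ := mem_transDoubleCoset_iff.mp hz
  exact normSq_theta_left lam _

variable [P.IsCrystallographic] [P.IsRootSystem] {b : P.Base}

/-- A chain that starts in the double coset and does not end with larger norm has constant norm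
throughout, so each step multiplies by an element of W on one side. -/
theorem affBruhatLE.mem_transDoubleCoset {lam : coweightLattice P} {z z' : ExtAffineWeyl P}
    (h : affBruhatLE b z z') (hz : z ∈ transDoubleCoset lam)
    (hn : normSq (Multiplicative.toAdd z'.left) ≤ normSq lam) : z' ∈ transDoubleCoset lam := by
  induction h with
  | refl => exact hz
  | tail _ hstep ih =>
    have h1 := ih (hstep.normSq_le.trans hn)
    rw [← normSq_of_mem_transDoubleCoset h1] at hn
    rcases hstep.eq_mul_ofIdx_of_normSq_le hn with ⟨i, rfl⟩ | ⟨i, rfl⟩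
    · exact finIncl_mul_mem_transDoubleCoset _ h1
    · exact mul_finIncl_mem_transDoubleCoset _ h1

theorem mem_transDoubleCoset_of_between {lam : coweightLattice P} {z d z' : ExtAffineWeyl P}
    (h : affBruhatLE b z d) (h' : affBruhatLE b d z') (hz : z ∈ transDoubleCoset lam)
    (hz' : z' ∈ transDoubleCoset lam) : d ∈ transDoubleCoset lam :=
  h.mem_transDoubleCoset hz (h'.normSq_le.trans (normSq_of_mem_transDoubleCoset hz').le)

theorem BruhatStep.mem_transDoubleCoset_of_isCominuscule {lam : coweightLattice P}
    (hlam : ∀ i, pair lam i ≤ 1) {c d : ExtAffineWeyl P} (h : BruhatStep b c d)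
    (hd : d ∈ transDoubleCoset lam) : c ∈ transDoubleCoset lam := by
  obtain ⟨i, k, n, hk, hn, hkn, hp, h1, h2⟩ := h.exists_left_data
  have h3 := hp i
  obtain ⟨x, y, rfl⟩ := mem_transDoubleCoset_iff.mp hd
  rw [pairingIn_same, pair_theta_left] at h3
  have h4 := hlam ((x, y).2⁻¹ • i)
  -- The translation part of d pairs with α_i to n - k - 2n = -(n + k), and also to -⟨λ, y⁻¹α_i⟩.
  -- Hence n + k ≤ 1.
  have h5 : k = 0 ∨ n = 0 := by omega
  rcases h5 with h5 | h5
  · have := finIncl_mul_mem_transDoubleCoset (weylGroup.ofIdx P i) hd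
    rw [h1 h5, ← mul_assoc, ← map_mul, ofIdx_mul_self, map_one, one_mul] at this
    exact this
  · obtain ⟨j, hj⟩ := h2 h5
    have := mul_finIncl_mem_transDoubleCoset (weylGroup.ofIdx P j) hd
    rw [hj, mul_assoc, ← map_mul, ofIdx_mul_self, map_one, mul_one] at this
    exact this

omit [Fintype ι] in
theorem theta_mul_parabolic {lam : coweightLattice P} {u : P.weylGroup}
    (hu : u ∈ parabolic P (stabSimple b lam)) (x y : P.weylGroup) :
    theta lam (x * u, y) = theta lam (x, y * u⁻¹) := by
  have h : translation (-lam) * finIncl P u⁻¹ = finIncl P u⁻¹ * translation (-lam) := by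
    apply extAffineWeyl_smul_ext
    intro a
    rw [mul_smul, mul_smul, finIncl_smul, finIncl_smul, translation_smul, translation_smul]
    simp [pair_smul_of_mem_parabolic (inv_mem hu)]
  simp only [theta, mul_inv_rev, ← map_inv, map_mul]
  rw [← mul_assoc, mul_assoc (finIncl P y), h, ← mul_assoc]

omit [Fintype ι] in
theorem theta_mul_parabolic_right {lam : coweightLattice P} {u : P.weylGroup}
    (hu : u ∈ parabolic P (stabSimple b lam)) (x y : P.weylGroup) :
    theta lam (x, y * u) = theta lam (x * u⁻¹, y) := by
  rw [theta_mul_parabolic (inv_mem hu), inv_inv]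

variable {lam : coweightLattice P}

theorem length_theta_of_mem_minReps (hlam : IsDominant b lam) {x : P.weylGroup}
    (hx : x ∈ minReps b (stabSimple b lam)) (y : P.weylGroup) :
    (length b (theta lam (x, y)) : ℤ) =
      length b (translation (-lam)) + length b (finIncl P y) - length b (finIncl P x) :=
  length_theta (fun _ => hlam.pair_nonneg) fun _ hi h0 =>
    Or.inr (isPos_smul_of_mem_minReps hlam hx hi h0)

omit [Fintype ι] in
theorem theta_mul_ofIdx_right (lam : coweightLattice P) (x y : P.weylGroup) (i : ι) :
    ∃ a, theta lam (x, y * weylGroup.ofIdx P i) = theta lam (x, y) * affReflection P a := by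
  refine ⟨(translation (-lam) * (finIncl P x)⁻¹)⁻¹ • ⟨i, 0⟩, ?_⟩
  rw [affReflection_smul_root, ← finIncl_ofIdx, inv_inv]
  simp only [theta, map_mul]
  group

theorem finLE.theta_right (hlam : IsDominant b lam) {x y y' : P.weylGroup} (h : finLE b y y')
    (hx : x ∈ minReps b (stabSimple b lam)) :
    affBruhatLE b (theta lam (x, y)) (theta lam (x, y')) := by
  refine finLE.induction (b := b)
    (p := fun y y' => affBruhatLE b (theta lam (x, y)) (theta lam (x, y')))
    (fun _ => .refl _) (fun _ _ _ => affBruhatLE.trans) (fun y i hl => BruhatStep.le ?_) h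
  refine ⟨theta_mul_ofIdx_right lam x y i, ?_⟩
  have h1 := length_theta_of_mem_minReps hlam hx y
  have h2 := length_theta_of_mem_minReps hlam hx (y * weylGroup.ofIdx P i)
  omega

/-- Lowering w raises θ(w, y). Here w is arbitrary, and the length formula holds because y sends all
positive roots orthogonal to λ to negative ones. -/
theorem finLE.theta_left (hlam : IsDominant b lam) {y w w' : P.weylGroup} (h : finLE b w w')
    (hy : ∀ j ∈ stabSimple b lam, ¬ b.IsPos (y • j)) :
    affBruhatLE b (theta lam (w', y)) (theta lam (w, y)) := by
  refine finLE.induction (b := b)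
    (p := fun w w' => affBruhatLE b (theta lam (w', y)) (theta lam (w, y)))
    (fun _ => .refl _) (fun _ _ _ h h' => affBruhatLE.trans h' h)
    (fun w i hl => BruhatStep.le ?_) h
  have hlen : ∀ w, (length b (theta lam (w, y)) : ℤ) =
      length b (translation (-lam)) + length b (finIncl P y) - length b (finIncl P w) := fun w =>
    length_theta (fun _ => hlam.pair_nonneg) fun _ hi h0 =>
      Or.inl (not_isPos_smul_of_forall_stabSimple hlam hy hi h0)
  refine ⟨⟨⟨w • i, 0⟩, ?_⟩, ?_⟩
  · rw [← finIncl_ofIdx, theta_mul_ofIdx, ofIdx_weylGroup_smul]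
    congr 2
    simp only [mul_assoc, inv_mul_cancel_left, ofIdx_mul_self, mul_one]
  · have h1 := hlen w
    have h2 := hlen (w * weylGroup.ofIdx P i)
    omega

/-! ### The Bruhat order on the double coset -/

variable [P.IsReduced] [P.IsIrreducible]

theorem theta_le_of_exists (hlam : IsDominant b lam) {x x' y y' u : P.weylGroup}
    (hx : x ∈ minReps b (stabSimple b lam)) (hx' : x' ∈ minReps b (stabSimple b lam))
    (hu : u ∈ parabolic P (stabSimple b lam)) (h : finLE b (y' * u) y)
    (h' : finLE b (x * u⁻¹) x') :
    affBruhatLE b (theta lam (x', y')) (theta lam (x, y)) := by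
  refine affBruhatLE.trans ?_ (h.theta_right hlam hx)
  -- Replacing (x', y') by (x' c, y' c) leaves θ unchanged and makes y' c negative on J, as
  -- `finLE.theta_left` needs. The inequality x u⁻¹ ≤ x' survives right multiplication by c because
  -- x' is minimal in its coset.
  obtain ⟨c, hc, hyc⟩ := exists_mul_parabolic_forall_not_isPos (b := b) lam y'
  have h1 := (h'.mul_parabolic hlam hx' hc).theta_left hlam hyc
  rwa [theta_mul_parabolic hc, mul_inv_cancel_right, theta_mul_parabolic hc,
    mul_inv_cancel_right, ← theta_mul_parabolic_right hu] at h1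

theorem exists_inv_of_finLE (hlam : IsDominant b lam) {x x' y y' v : P.weylGroup}
    (hx : x ∈ minReps b (stabSimple b lam))
    (hv : v ∈ parabolic P (stabSimple b lam)) (h : finLE b y' (y * v))
    (h' : finLE b (x * v) x') :
    ∃ u ∈ parabolic P (stabSimple b lam), finLE b (y' * u) y ∧ finLE b (x * u⁻¹) x' := by
  obtain ⟨u, hu, h1, h2⟩ := h.exists_mul_parabolic_le hlam hx hv
  exact ⟨u, hu, h1, h2.trans h'⟩

/-- The relation corresponding to the Bruhat order on `W t^{-lam} W`: there is `v ∈ W_J` with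
`y' ≤ y v` and `x v ≤ x'`. -/
def cosetLE (b : P.Base) (lam : coweightLattice P) (p' p : P.weylGroup × P.weylGroup) : Prop :=
  ∃ v ∈ parabolic P (stabSimple b lam), finLE b p'.2 (p.2 * v) ∧ finLE b (p.1 * v) p'.1

theorem cosetLE.trans (hlam : IsDominant b lam) {p q r : P.weylGroup × P.weylGroup}
    (hq : q.1 ∈ minReps b (stabSimple b lam))
    (h : cosetLE b lam p q) (h' : cosetLE b lam q r) : cosetLE b lam p r := by
  obtain ⟨v, hv, h1, h2⟩ := h
  obtain ⟨v', hv', h3, h4⟩ := h'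
  obtain ⟨v₁, hv₁, h5, h6⟩ := h3.exists_mul_parabolic hlam hq hv
  refine ⟨v' * v₁, mul_mem hv' hv₁, ?_, ?_⟩
  · rw [← mul_assoc]
    exact h1.trans h5
  · rw [← mul_assoc]
    exact ((h4.mul_parabolic hlam hq hv₁).trans h6).trans h2

/-- With unchanged norm the step is a finite reflection on the left, which changes y, or on the
right, which changes x. In each case the length formula determines the direction of the change. -/
theorem BruhatStep.exists_cosetLE (hlam : IsDominant b lam) {x y : P.weylGroup}
    (hx : x ∈ minReps b (stabSimple b lam)) {d : ExtAffineWeyl P}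
    (h : BruhatStep b (theta lam (x, y)) d)
    (hd : normSq (Multiplicative.toAdd d.left) ≤ normSq lam) :
    ∃ q : P.weylGroup × P.weylGroup, q.1 ∈ minReps b (stabSimple b lam) ∧ d = theta lam q ∧
      cosetLE b lam (x, y) q := by
  rw [← normSq_theta_left lam (x, y)] at hd
  have hright : ∀ i, length b (theta lam (x, y)) <
      length b (theta lam (x, y * weylGroup.ofIdx P i)) → finLE b y (y * weylGroup.ofIdx P i) := by
    intro i hl
    refine (bruhatStep_mul_ofIdx ?_).le
    have h1 := length_theta_of_mem_minReps hlam hx y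
    have h2 := length_theta_of_mem_minReps hlam hx (y * weylGroup.ofIdx P i)
    omega
  rcases h.eq_mul_ofIdx_of_normSq_le hd with ⟨i, rfl⟩ | ⟨i, rfl⟩
  · have h1 := h.2
    have h2 : weylGroup.ofIdx P i * y = y * weylGroup.ofIdx P (y⁻¹ • i) := by
      rw [ofIdx_weylGroup_smul, inv_inv]
      simp only [mul_assoc, mul_inv_cancel_left]
    rw [finIncl_mul_theta, h2] at h1 ⊢
    exact ⟨(x, y * weylGroup.ofIdx P (y⁻¹ • i)), hx, rfl, 1, one_mem _, by simpa using hright _ h1, by simpa using finLE.refl x⟩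
  · obtain ⟨j, hj, hij⟩ : ∃ j, b.IsPos j ∧ weylGroup.ofIdx P i = weylGroup.ofIdx P (x • j) := by
      by_cases h1 : b.IsPos (x⁻¹ • i)
      · exact ⟨_, h1, by rw [smul_inv_smul]⟩
      · exact ⟨_, (isPos_negIdx b).mpr h1, by rw [smul_negIdx, smul_inv_smul, ofIdx_negIdx]⟩
    rw [hij] at h ⊢
    have hxj : weylGroup.ofIdx P (x • j) * x = x * weylGroup.ofIdx P j := by
      rw [ofIdx_weylGroup_smul, inv_mul_cancel_right]
    by_cases hpos : b.IsPos (x • j)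
    · have h2 : pair lam j = 0 := by
        refine le_antisymm (not_lt.mp fun hlt => ?_) (hlam.pair_nonneg hj)
        have h3 := h.2
        rw [← affReflection_negIdx_zero,
          length_lt_mul_affReflection_iff (affRoot_negIdx_isPos_iff.mpr hpos)] at h3
        have h4 : (theta lam (x, y) • (⟨negIdx P (x • j), 0⟩ : AffRoot ι)).lvl =
            -pair lam j := by
          rw [smul_lvl, pair_theta_left, theta_right, mul_smul]
          simp
        rw [AffRoot.IsPos, h4, minLevel] at h3
        split_ifs at h3 <;> omega
      have hmem : weylGroup.ofIdx P j ∈ parabolic P (stabSimple b lam) := by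
        refine mem_parabolic_of_pair_smul hlam fun i => ?_
        rw [ofIdx_smul_index, pair_of_root_eq_sub_zsmul (root_reflectionPerm_eq j i), h2, mul_zero,
          sub_zero]
      have h3 := h.2
      rw [theta_mul_ofIdx, hxj, theta_mul_parabolic hmem, ofIdx_inv] at h3 ⊢
      exact ⟨(x, y * weylGroup.ofIdx P j), hx, rfl, 1, one_mem _, by simpa using hright _ h3, by simpa using finLE.refl x⟩
    -- Here x s_j < x, but x s_j need not be minimal in its coset. Its W_J-part u moves over to y
    -- and is the witness v of the relation.
    · obtain ⟨x₂, hx₂, u, hu, hxu⟩ :=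
        exists_minReps_mul (b := b) (stabSimple b lam) (x * weylGroup.ofIdx P j)
      rw [theta_mul_ofIdx, hxj, hxu, theta_mul_parabolic hu]
      refine ⟨(x₂, y * u⁻¹), hx₂, rfl, u, hu, ?_, ?_⟩
      · simpa using finLE.refl y
      · rw [← hxu]
        exact (bruhatStep_of_mul_ofIdx ((length_mul_ofIdx_lt_iff hj).mpr hpos)).le

theorem affBruhatLE.exists_cosetLE (hlam : IsDominant b lam) {x y : P.weylGroup}
    (hx : x ∈ minReps b (stabSimple b lam)) {d : ExtAffineWeyl P}
    (h : affBruhatLE b (theta lam (x, y)) d)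
    (hd : normSq (Multiplicative.toAdd d.left) ≤ normSq lam) :
    ∃ q : P.weylGroup × P.weylGroup, q.1 ∈ minReps b (stabSimple b lam) ∧ d = theta lam q ∧
      cosetLE b lam (x, y) q := by
  induction h with
  | refl => exact ⟨(x, y), hx, rfl, 1, one_mem _, by simpa using finLE.refl y, by simpa using finLE.refl x⟩
  | tail _ hstep ih =>
    obtain ⟨q, hq, rfl, h1⟩ := ih (hstep.normSq_le.trans hd)
    obtain ⟨r, hr, rfl, h2⟩ := BruhatStep.exists_cosetLE hlam (x := q.1) (y := q.2) hq hstep hd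
    exact ⟨r, hr, rfl, h1.trans hlam hq h2⟩

/-- Equal translation parts put y⁻¹ y' in the stabilizer W_J of λ. Equal finite parts then put x and
x' in the same coset, where the minimal representative is unique. -/
theorem theta_injOn (hlam : IsDominant b lam) :
    Set.InjOn (theta lam) (pairs b (stabSimple b lam)) := by
  rintro ⟨x, y⟩ ⟨hx, -⟩ ⟨x', y'⟩ ⟨hx', -⟩ h
  have h1 : ∀ i, pair lam (y⁻¹ • i) = pair lam (y'⁻¹ • i) := by
    intro i
    have h2 := pair_theta_left lam (x, y) i
    rw [h, pair_theta_left, neg_inj] at h2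
    exact h2.symm
  have h2 := theta_right lam (x, y)
  rw [h, theta_right] at h2
  simp only at h2 hx hx'
  have hv : y⁻¹ * y' ∈ parabolic P (stabSimple b lam) :=
    mem_parabolic_of_pair_smul hlam fun i => by rw [mul_smul, h1, inv_smul_smul]
  have hx'' : x' = x * (y⁻¹ * y') := by
    have h3 : x'⁻¹ = y'⁻¹ * (y * x⁻¹) := by rw [← h2, inv_mul_cancel_left]
    rw [← inv_inj, h3]
    group
  have h3 := eq_one_of_mul_mem_minReps hlam hx hv (hx'' ▸ hx')
  rw [h3, mul_one] at hx''
  rw [hx'', inv_mul_eq_one.mp h3]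

theorem theta_le_iff (hlam : IsDominant b lam) {p' p : P.weylGroup × P.weylGroup}
    (hp' : p'.1 ∈ minReps b (stabSimple b lam)) (hp : p.1 ∈ minReps b (stabSimple b lam)) :
    affBruhatLE b (theta lam p') (theta lam p) ↔ cosetLE b lam p' p := by
  constructor
  · intro h
    obtain ⟨q, hq, h1, h2⟩ := affBruhatLE.exists_cosetLE hlam (x := p'.1) (y := p'.2) hp' h
      (normSq_theta_left lam p).le
    rwa [theta_injOn hlam ⟨hp, trivial⟩ ⟨hq, trivial⟩ h1]
  · rintro ⟨v, hv, h1, h2⟩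
    obtain ⟨u, hu, h3, h4⟩ := exists_inv_of_finLE hlam hp hv h1 h2
    exact theta_le_of_exists hlam hp hp' hu h3 h4

omit [P.IsReduced] [P.IsIrreducible] in
theorem theta_surjOn :
    Set.SurjOn (theta lam) (pairs b (stabSimple b lam)) (transDoubleCoset lam) := by
  intro z hz
  obtain ⟨w, y, rfl⟩ := mem_transDoubleCoset_iff.mp hz
  obtain ⟨x, hx, u, hu, rfl⟩ := exists_minReps_mul (b := b) (stabSimple b lam) w
  exact ⟨(x, y * u⁻¹), ⟨hx, trivial⟩, (theta_mul_parabolic hu x y).symm⟩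

omit [Fintype ι] [P.IsCrystallographic] [P.IsRootSystem] [P.IsReduced] [P.IsIrreducible] in
theorem theta_mem_transDoubleCoset (p : P.weylGroup × P.weylGroup) :
    theta lam p ∈ transDoubleCoset lam := mem_transDoubleCoset_iff.mpr ⟨p.1, p.2, rfl⟩

end DoubleCoset

end ExtAffine

end

/-! ### Graded posets -/

namespace ExtAffine

theorem IsGradedPoset.of_convex {α : Type*} {s t : Set α} {r : α → α → Prop} {ρ : α → ℤ}
    (h : IsGradedPoset s r ρ) (hts : t ⊆ s)
    (hconv : ∀ a ∈ t, ∀ c ∈ t, ∀ d ∈ s, r a d → r d c → d ∈ t) : IsGradedPoset t r ρ where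
  refl a ha := h.refl a (hts ha)
  antisymm a ha c hc := h.antisymm a (hts ha) c (hts hc)
  trans a ha c hc d hd := h.trans a (hts ha) c (hts hc) d (hts hd)
  strictMono a ha c hc := h.strictMono a (hts ha) c (hts hc)
  cover a ha c hc hac hne hcov := h.cover a (hts ha) c (hts hc) hac hne fun d hd had hdc =>
    hcov d (hconv a ha c hc d hd had hdc) had hdc

theorem IsGradedPoset.comap {α β : Type*} {f : α → β} {s : Set α} {r : α → α → Prop} {ρ : α → ℤ}
    {t : Set β} {r' : β → β → Prop} {ρ' : β → ℤ} (h : IsGradedPoset t r' ρ')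
    (hf : Set.BijOn f s t) (hr : ∀ a ∈ s, ∀ c ∈ s, r a c ↔ r' (f a) (f c))
    (hρ : ∀ a ∈ s, ρ' (f a) = ρ a) : IsGradedPoset s r ρ where
  refl a ha := (hr a ha a ha).mpr (h.refl _ (hf.mapsTo ha))
  antisymm a ha c hc hac hca := hf.injOn ha hc (h.antisymm _ (hf.mapsTo ha) _ (hf.mapsTo hc)
    ((hr a ha c hc).mp hac) ((hr c hc a ha).mp hca))
  trans a ha c hc d hd hac hcd := (hr a ha d hd).mpr (h.trans _ (hf.mapsTo ha) _ (hf.mapsTo hc) _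
    (hf.mapsTo hd) ((hr a ha c hc).mp hac) ((hr c hc d hd).mp hcd))
  strictMono a ha c hc hac hne := by
    rw [← hρ a ha, ← hρ c hc]
    exact h.strictMono _ (hf.mapsTo ha) _ (hf.mapsTo hc) ((hr a ha c hc).mp hac)
      (hf.injOn.ne ha hc hne)
  cover a ha c hc hac hne hcov := by
    rw [← hρ a ha, ← hρ c hc]
    refine h.cover _ (hf.mapsTo ha) _ (hf.mapsTo hc) ((hr a ha c hc).mp hac)
      (hf.injOn.ne ha hc hne) fun d hd had hdc => ?_
    obtain ⟨e, he, rfl⟩ := hf.surjOn hd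
    rcases hcov e he ((hr a ha e he).mpr had) ((hr e he c hc).mpr hdc) with rfl | rfl
    · exact Or.inl rfl
    · exact Or.inr rfl

theorem IsGradedPosetIso.of_target {α β : Type*} {f : α → β} {s : Set α} {r : α → α → Prop}
    {ρ : α → ℤ} {t : Set β} {r' : β → β → Prop} {ρ' : β → ℤ} (h : IsGradedPoset t r' ρ')
    (hf : Set.BijOn f s t) (hr : ∀ a ∈ s, ∀ c ∈ s, r a c ↔ r' (f a) (f c))
    (hρ : ∀ a ∈ s, ρ' (f a) = ρ a) : IsGradedPosetIso f s r ρ t r' ρ' :=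
  ⟨h.comap hf hr hρ, h, hf, hr, hρ⟩

/-! ### Gradedness, the admissible set and the main theorem -/

open RootPairing

variable {ι M N : Type*} [Fintype ι] [AddCommGroup M] [Module ℝ M] [AddCommGroup N] [Module ℝ N]
  {P : RootPairing ι ℝ M N} [P.IsRootSystem] [P.IsCrystallographic] [P.IsReduced]
  [P.IsIrreducible] {b : P.Base} {lam : coweightLattice P}

theorem isGradedPoset_transDoubleCoset :
    IsGradedPoset (transDoubleCoset lam) (bruhatOp b) (opRank b lam) := by
  have hop : bruhatOp b = fun z z' => affBruhatLE b z' z := by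
    funext z z'
    exact propext bruhatLE_iff
  rw [hop]
  refine ⟨fun a _ => .refl a, fun a _ c _ h h' => h'.antisymm h,
    fun a _ c _ d _ h h' => h'.trans h, fun a _ c _ h hne => ?_, fun a ha c hc h hne hcov => ?_⟩
  · have := h.length_lt hne.symm
    simp only [opRank]
    omega
  · obtain ⟨z, h1, h2, h3⟩ := exists_affBruhatLE_length_eq_add_one h hne.symm
    have hz := mem_transDoubleCoset_of_between h1 h2 hc ha
    simp only [opRank]
    rcases hcov z hz h2 h1 with rfl | rfl
    · omega
    · omega

omit [P.IsRootSystem] [P.IsCrystallographic] [P.IsReduced] [P.IsIrreducible] [Fintype ι] in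
theorem translation_weylActCoweight (w : P.weylGroup) :
    translation (-weylActCoweight w lam) = theta lam (w, w) := by
  refine SemidirectProduct.ext ?_ ?_
  · have h := toAdd_theta_left lam (w, w)
    rw [map_neg] at h
    exact (congrArg Multiplicative.ofAdd h).symm
  · rw [theta_right, mul_inv_cancel]
    rfl

/-- As t^{-wλ} = θ(w, w) = θ(x, x) for w ∈ x W_J, the criterion reads y ≤ x v and x v ≤ p.1 for some
v ∈ W_J, where y = p.2; these combine to y ≤ p.1. Conversely θ(p.1, y) ≤ θ(p.1, p.1) = t^{-p.1 λ}.
-/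
theorem theta_mem_admissible_iff (hlam : IsDominant b lam) {p : P.weylGroup × P.weylGroup}
    (hp : p.1 ∈ minReps b (stabSimple b lam)) :
    theta lam p ∈ admissible b lam ↔ finLE b p.2 p.1 := by
  constructor
  · rintro ⟨w, hw⟩
    obtain ⟨x, hx, u, hu, rfl⟩ := exists_minReps_mul (b := b) (stabSimple b lam) w
    rw [bruhatLE_iff, translation_weylActCoweight, theta_mul_parabolic hu,
      mul_inv_cancel_right] at hw
    obtain ⟨v, -, h1, h2⟩ := (theta_le_iff hlam (p' := p) (p := (x, x)) hp hx).mp hw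
    exact h1.trans h2
  · intro h
    refine ⟨p.1, ?_⟩
    rw [bruhatLE_iff, translation_weylActCoweight]
    exact h.theta_right hlam hp

theorem admissible_subset_of_isCominuscule (h : IsCominuscule b lam) :
    admissible b lam ⊆ transDoubleCoset lam := by
  obtain ⟨i, hi, hi1, hi0, hle⟩ := h
  have hdom : IsDominant b lam := by
    intro j hj
    rcases eq_or_ne j i with rfl | hji
    · rw [hi1]; exact zero_le_one
    · rw [hi0 j hj hji]
  have hle' : ∀ j, pair lam j ≤ 1 := by
    intro j
    by_cases hj : b.IsPos j
    · exact hle j hj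
    · have := hdom.pair_nonneg ((isPos_negIdx b).mpr hj)
      rw [pair_negIdx] at this
      linarith
  rintro z ⟨w, hz⟩
  rw [bruhatLE_iff, translation_weylActCoweight] at hz
  induction hz using Relation.ReflTransGen.head_induction_on with
  | refl => exact theta_mem_transDoubleCoset _
  | head hstep _ ih => exact hstep.mem_transDoubleCoset_of_isCominuscule hle' ih

end ExtAffine

/-- Let `lam` be a dominant coweight of a reduced irreducible crystallographic root system and let `J`
be the set of simple roots orthogonal to it. -/
theorem theorem2 {ι M N : Type*} [Fintype ι] [AddCommGroup M] [Module ℝ M]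
    [AddCommGroup N] [Module ℝ N] (P : RootPairing ι ℝ M N) [P.IsRootSystem]
    [P.IsCrystallographic] [P.IsReduced] [P.IsIrreducible] (b : P.Base)
    (lam : ExtAffine.coweightLattice P) (hlam : ExtAffine.IsDominant b lam)
    (J : Set ι) (hJ : J = ExtAffine.stabSimple b lam) :
    -- equivalent conditions for comparability
    (∀ x ∈ ExtAffine.minReps b J, ∀ x' ∈ ExtAffine.minReps b J, ∀ y y' : P.weylGroup,
      List.TFAE [
        ExtAffine.bruhatLE b
          (ExtAffine.finIncl P y' * ExtAffine.translation (-lam) * (ExtAffine.finIncl P x')⁻¹)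
          (ExtAffine.finIncl P y * ExtAffine.translation (-lam) * (ExtAffine.finIncl P x)⁻¹),
        ∃ u ∈ ExtAffine.parabolic P J,
          ExtAffine.finBruhatLE b (y' * u) y ∧ ExtAffine.finBruhatLE b (x * u⁻¹) x',
        ∃ v ∈ ExtAffine.parabolic P J,
          ExtAffine.finBruhatLE b y' (y * v) ∧ ExtAffine.finBruhatLE b (x * v) x']) ∧
    -- part (1)
    ExtAffine.IsGradedPosetIso (ExtAffine.theta lam)
      (ExtAffine.pairs b J) (ExtAffine.pairLE b J) (ExtAffine.pairRank b)
      (ExtAffine.transDoubleCoset lam) (ExtAffine.bruhatOp b) (ExtAffine.opRank b lam) ∧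
    -- part (2)
    ExtAffine.IsGradedPosetIso (ExtAffine.theta lam)
      (ExtAffine.pairsQ b J) (ExtAffine.pairLE b J) (ExtAffine.pairRank b)
      (ExtAffine.transDoubleCoset lam ∩ ExtAffine.admissible b lam) (ExtAffine.bruhatOp b)
      (ExtAffine.opRank b lam) ∧
    -- the cominuscule case
    (ExtAffine.IsCominuscule b lam →
      ExtAffine.transDoubleCoset lam ∩ ExtAffine.admissible b lam =
        ExtAffine.admissible b lam) := by
  subst hJ
  have hiso : ∀ p ∈ ExtAffine.pairs b (ExtAffine.stabSimple b lam),
      ∀ q ∈ ExtAffine.pairs b (ExtAffine.stabSimple b lam),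
      ExtAffine.pairLE b (ExtAffine.stabSimple b lam) p q ↔
        ExtAffine.bruhatOp b (ExtAffine.theta lam p) (ExtAffine.theta lam q) := by
    intro p hp q hq
    rw [ExtAffine.bruhatOp, ExtAffine.bruhatLE_iff, ExtAffine.theta_le_iff hlam hq.1 hp.1]
    simp only [ExtAffine.pairLE, ExtAffine.cosetLE, ExtAffine.finBruhatLE_iff]
    exact exists_congr fun u => and_congr_right fun _ => and_comm
  have hrank : ∀ p ∈ ExtAffine.pairs b (ExtAffine.stabSimple b lam),
      ExtAffine.opRank b lam (ExtAffine.theta lam p) = ExtAffine.pairRank b p := by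
    intro p hp
    have h : (ExtAffine.length b (ExtAffine.theta lam p) : ℤ) = _ :=
      ExtAffine.length_theta_of_mem_minReps hlam hp.1 p.2
    simp only [ExtAffine.opRank, ExtAffine.pairRank]
    omega
  have hgraded := ExtAffine.isGradedPoset_transDoubleCoset (b := b) (lam := lam)
  have hinj := ExtAffine.theta_injOn hlam
  have hsub : ExtAffine.pairsQ b (ExtAffine.stabSimple b lam) ⊆
      ExtAffine.pairs b (ExtAffine.stabSimple b lam) := fun p hp => hp.1
  refine ⟨fun x hx x' hx' y y' => ?_, ?_, ?_, fun hcom => ?_⟩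
  · simp only [ExtAffine.bruhatLE_iff, ExtAffine.finBruhatLE_iff]
    tfae_have 1 → 3 := fun h =>
      (ExtAffine.theta_le_iff hlam (p' := (x', y')) (p := (x, y)) hx' hx).mp h
    tfae_have 3 → 2 := fun ⟨v, hv, h1, h2⟩ => ExtAffine.exists_inv_of_finLE hlam hx hv h1 h2
    tfae_have 2 → 1 := fun ⟨u, hu, h1, h2⟩ => ExtAffine.theta_le_of_exists hlam hx hx' hu h1 h2
    tfae_finish
  · exact .of_target hgraded ⟨fun p _ => ExtAffine.theta_mem_transDoubleCoset p, hinj,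
      ExtAffine.theta_surjOn⟩ hiso hrank
  · refine .of_target (hgraded.of_convex Set.inter_subset_left ?_)
      ⟨fun p hp => ⟨ExtAffine.theta_mem_transDoubleCoset p, ?_⟩, hinj.mono hsub, ?_⟩
      (fun p hp q hq => hiso p (hsub hp) q (hsub hq)) fun p hp => hrank p (hsub hp)
    -- The admissible set is closed downwards in the Bruhat order, hence convex, so it inherits the
    -- grading of the double coset.
    · rintro z ⟨-, w, hw⟩ - - d hd hzd -
      refine ⟨hd, w, ?_⟩
      rw [ExtAffine.bruhatOp] at hzd
      rw [ExtAffine.bruhatLE_iff] at *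
      exact hzd.trans hw
    · exact (ExtAffine.theta_mem_admissible_iff hlam hp.1.1).mpr
        (ExtAffine.finBruhatLE_iff.mp hp.2)
    · rintro z ⟨hz, hadm⟩
      obtain ⟨p, hp, rfl⟩ := ExtAffine.theta_surjOn (b := b) hz
      exact ⟨p, ⟨hp, ExtAffine.finBruhatLE_iff.mpr
        ((ExtAffine.theta_mem_admissible_iff hlam hp.1).mp hadm)⟩, rfl⟩
  · exact Set.inter_eq_right.mpr (ExtAffine.admissible_subset_of_isCominuscule hcom)
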